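/- **Conventions.** Let $\mathcal O$ be a discrete valuation ring with uniformizer $t$, perfect residue field $k=\mathcal O/(t)$ and fraction field $K$, and let $p$ be the characteristic exponent of $K$. An *affine $\mathcal O$-curve* is a faithfully flat integral affine scheme $C=\operatorname{Spec}R$ of finite type over $\mathcal O$, of relative dimension $1$, such that $K$ is algebraically closed in $\operatorname{Frac}R$. A $\mathbb G_{a,\mathcal O}$-action on $C$ is given by its comorphism $R\to R[T]$, $b\mapsto\sum_{i\ge 0}\delta^{(i)}(b)T^i$; it is *free* if the ideal of $R$ generated by all $\delta^{(i)}(b)$ with $i>0$, $b\in R$ is $R$. **Theorem.** Let $C$ be an affine $\mathcal O$-curve which has a free $\mathbb G_{a,\mathcal O}$-action and whose special fiber is reduced. Then there exist a natural number $n\ge 1$ and polynomials $f_i\in\mathcal O[x_1,\dots,x_i]$ for $1\le i\le n$ such that, as $\mathcal O$-schemes, $$C\simeq\operatorname{Spec}\mathcal O[x_1,\dots,x_{n+1}]/(tx_2-f_1,\dots,tx_{n+1}-f_n),$$ and the following hold. (i) The ideal $(t,f_1,\dots,f_n)$ of $\mathcal O[x_1,\dots,x_n]$ is $0$-dimensional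 and radical, and for each $1\le i\le n$ the class of $\partial f_i/\partial x_i$ is invertible modulo $(t,f_1,\dots,f_i)$. (ii) Define $\alpha_1(x)=x$ and $\alpha_{i+1}(x)=t^{-1}f_i(\alpha_1(x),\dots,\alpha_i(x))\in K[x]$ for $1\le i\le n$, and let $B=\mathcal O[\alpha_1(x),\dots,\alpha_{n+1}(x)]\subseteq K[x]$. Then $x_i\mapsto\alpha_i(x)$ induces an isomorphism of $\mathcal O[x_1,\dots,x_{n+1}]/(tx_2-f_1,\dots,tx_{n+1}-f_n)$ onto $B$. Under the resulting identification $C\simeq\operatorname{Spec}B$, restricting actions from $K[x]$ to $B$ gives a one-to-one correspondence between the $\mathbb G_{a,K}$-actions on $\mathbb A^1_K=\operatorname{Spec}K[x]$ of the form $$x\mapsto x+\sum_{j=1}^r\lambda_jT^{p^{s_j}}\qquad(r\ge 0,\ s_j\in\mathbb Z_{\ge0},\ \lambda_j\in K),$$ with $T$ the coordinate of $\mathbb G_{a,K}$, that let the algebra $B$ stable (i.e. whose comorphism maps $B$ into $B[T]$), and all the $\mathbb G_{a,\mathcal O}$-actions on $C$. -/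

import Mathlib

open Polynomial

/-- An affine curve `Spec B` over the discrete valuation ring `O`, expressed through the `O`-algebra
`B`: integral, faithfully flat, of finite type, of relative dimension one, and such that the
fraction field of `O` is algebraically closed in the function field `Frac B`. -/
structure IsAffineCurve (O B : Type*) [CommRing O] [CommRing B] [Algebra O B] : Prop where
  isDomain : IsDomain B
  faithfullyFlat : Module.FaithfullyFlat O B
  finiteType : Algebra.FiniteType O B
  /-- Relative dimension one: every fibre of `Spec B → Spec O` has dimension one. -/
  relativeDimension : ∀ (P : Ideal O) [P.IsPrime], ringKrullDim (P.Fiber B) = 1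
  /-- An element of `Frac B` algebraic over `O` (equivalently, over `Frac O`) is a fraction of
  elements of `O`. -/
  algebraicallyClosed : ∀ y : FractionRing B, IsAlgebraic O y →
    ∃ a b : O, b ≠ 0 ∧ algebraMap O (FractionRing B) b * y = algebraMap O (FractionRing B) a

/-- An action of the additive group scheme over `R` on the affine `R`-scheme `Spec B`, given by the
comorphism `B → B[T]` of the action morphism. -/
structure GaAction (R B : Type*) [CommRing R] [CommRing B] [Algebra R B] where
  /-- The comorphism `exp (δ T) : B → B[T]`. -/
  exp : B →ₐ[R] B[X]
  /-- The neutral element acts as the identity. -/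
  exp_zero : ∀ b, (exp b).eval 0 = b
  /-- Acting by one parameter (the inner variable) after another one (the outer variable) is acting
  by their sum. -/
  exp_add : ∀ b, (exp b).map (exp : B →+* B[X]) = (exp b).eval₂ (C.comp C) (X + C X)

namespace GaAction

variable {R B : Type*} [CommRing R] [CommRing B] [Algebra R B]

/-- The `i`-th component of the locally finite iterative higher derivation of an action:
`exp (δ T) b = ∑ i, δ i b * T ^ i`. -/
noncomputable def δ (ρ : GaAction R B) (i : ℕ) (b : B) : B := (ρ.exp b).coeff i

/-- The action is free: the ideal generated by all `δ i b` with `i > 0` is the unit ideal. -/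
def IsFree (ρ : GaAction R B) : Prop :=
  Ideal.span {y : B | ∃ i : ℕ, 0 < i ∧ ∃ b : B, y = ρ.δ i b} = ⊤

/-- The action lets the subset `A` of `B` stable: `exp (δ T)` maps `A` into `A[T]`. -/
def Stabilizes (ρ : GaAction R B) (A : Set B) : Prop :=
  ∀ b ∈ A, ∀ i : ℕ, ρ.δ i b ∈ A

/-- An action on the affine line `Spec K[x]` is of the form `x ↦ x + ∑ j, λ j * T ^ (p ^ s j)`. -/
def IsAdditive {K : Type*} [Field K] (p : ℕ) (σ : GaAction K K[X]) : Prop :=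
  ∃ (r : ℕ) (s : Fin r → ℕ) (l : Fin r → K),
    σ.exp X = C X + ∑ j, C (C (l j)) * X ^ (p ^ s j)

end GaAction

/-- The ideal `(t x₂ - f₁, …, t xₙ₊₁ - fₙ)` of `O[x₁, …, xₙ₊₁]`; variables are numbered
from zero. -/
noncomputable def presentationIdeal {O : Type*} [CommRing O] (t : O) {n : ℕ}
    (f : Fin n → MvPolynomial (Fin n) O) : Ideal (MvPolynomial (Fin (n + 1)) O) :=
  Ideal.span (Set.range fun i : Fin n =>
    MvPolynomial.C t * MvPolynomial.X i.succ - MvPolynomial.rename Fin.castSucc (f i))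

/-- The ideal `(t, f₁, …, fₘ)` of `O[x₁, …, xₙ]`, generated by `t` and the `f i` with `i < m`
(counted from zero). -/
noncomputable def centerIdeal {O : Type*} [CommRing O] (t : O) {n : ℕ}
    (f : Fin n → MvPolynomial (Fin n) O) (m : ℕ) : Ideal (MvPolynomial (Fin n) O) :=
  Ideal.span ({MvPolynomial.C t} ∪ {g | ∃ i : Fin n, (i : ℕ) < m ∧ g = f i})

/-!
Write `Spec B` for the curve, `π : B → A` for the restriction to the special fibre, `k` for the
residue field. The theorem says that `Spec B` is obtained from the affine line `Spec O[x₁]` by `n`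
successive dilatations (affine modifications) along étale centres of the special fibre, and that
`n` is read off from the divisibility by `t` of one translation polynomial.

*Invariants.* On a curve over a field, an invariant element of a free action is algebraic over the
field (`GaAction.isAlgebraic_of_isInvariant`): each irreducible component is stable and carries a
nontrivial action, and if an invariant `a` were transcendental on it, every function would be
algebraic over the invariant ring `k[a]`, hence invariant. This is applied to both fibres of
`Spec B`. On the generic fibre it shows that the invariants of `B` are fractions of elements of `O`.

*The additive coordinate.* An element of minimal positive degree in `T`, rescaled, satisfies
`exp x = x + l(T)` with `l ∈ O[T]`, and its powers generate `B` after inverting `O`, because the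
degree of `l` is a power of `p` and divides all degrees in `T` (`GaAction.exists_isSlice`).
Rescaling once more, `l = t ^ n * l'` with `n ≥ 1` and `l'` nonzero modulo `t`.

*The tower.* Put `b 0 = x`. As long as `b i` is translated by a multiple of `t`, its restriction
`π (b i)` is invariant, hence algebraic over `k`. The subalgebra `L` generated by
`π (b 0), …, π (b (i - 1))` is finite over `k` and reduced, so the relations of `π (b i)` over `L`
are generated by a single polynomial, which is separable since `k` is perfect. A lift `f i` of it
satisfies `f i (b 0, …, b i) = t * b (i + 1)` for some `b (i + 1)` in `B`
(`IsDilatationTower.exists_succ`). By the first order Taylor formula in the last variable, the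
translation of `b (i + 1)` is divisible by one power of `t` less than that of `b i`, and up to that
power it is a unit multiple of `l'` in the special fibre (`IsTranslatedBy.succ`). After exactly `n`
steps the translation of `b n` is not zero in the special fibre, so `π (b n)` is transcendental over
the preceding elements (`IsDilatationTower.mem_towerIdeal_of_isTranslatedBy`). Therefore every
relation modulo `t` between `b 0, …, b n` follows from `t, f 0, …, f (n - 1)`, and dividing by `t`
repeatedly shows that the `b j` generate `B` with the expected relations
(`IsDilatationTower.mem_presentationIdeal_iff`, `IsDilatationTower.aeval_surjective`).

*Actions.* Since `B` is flat and generically generated by `x`, it embeds into `K[x]`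
(`exists_algHom_polynomial`). An action on `B` extends to `K[x]`, because it is determined by the
image of `x`, and every action on `K[x]` is additive (`GaAction.isAdditive`). Conversely an action
on `K[x]` which lets `B` stable restricts to it (`GaAction.exists_equiv_stabilizes`).
-/

/-! ### Transcendence degree of one-dimensional algebras -/

/-- The transcendence degree of a one-dimensional domain is at most one: in a polynomial subring
over which it is integral, the prime ideal generated by a variable lies below a maximal ideal. -/
theorem MvPolynomial.le_one_of_isIntegral_of_krullDimLE_one {k D : Type*} [Field k] [CommRing D]
    [IsDomain D] [Ring.KrullDimLE 1 D] {s : ℕ} (g : MvPolynomial (Fin s) k →+* D)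
    (hg : Function.Injective g) (hint : g.IsIntegral) : s ≤ 1 := by
  by_contra! hs
  let := g.toAlgebra
  have : Algebra.IsIntegral (MvPolynomial (Fin s) k) D := ⟨hint⟩
  let i0 : Fin s := ⟨0, by omega⟩
  let i1 : Fin s := ⟨1, hs⟩
  have hne : i1 ≠ i0 := by simp [i0, i1]
  let P : Ideal (MvPolynomial (Fin s) k) := Ideal.span {MvPolynomial.X i0}
  have hP0 : MvPolynomial.X i0 ≠ (0 : MvPolynomial (Fin s) k) := MvPolynomial.X_ne_zero _
  have hPp : P.IsPrime := (Ideal.span_singleton_prime hP0).2 (MvPolynomial.X_prime (R := k))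
  obtain ⟨Q, -, hQ, hQP⟩ := Ideal.exists_ideal_over_prime_of_isIntegral P (⊥ : Ideal D) (by
    intro x hx
    rw [Ideal.mem_comap, Ideal.mem_bot] at hx
    have : x = 0 := hg (by rw [map_zero]; exact hx)
    rw [this]; exact P.zero_mem)
  have hQ0 : Q ≠ ⊥ := by
    rintro rfl
    have h : MvPolynomial.X i0 ∈ Ideal.comap (algebraMap (MvPolynomial (Fin s) k) D) ⊥ := by
      rw [hQP]; exact Ideal.mem_span_singleton_self _
    rw [Ideal.mem_comap, Ideal.mem_bot] at h
    exact hP0 (hg (by rw [map_zero]; exact h))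
  have hQm := hQ.isMaximal_of_ne_bot hQ0
  have hPm : P.IsMaximal := by
    rw [← hQP]; exact Ideal.isMaximal_comap_of_isIntegral_of_isMaximal Q
  -- the quotient by `X 0` is not a field: it surjects onto `k`, killing the nonzero class of `X 1`
  let c : MvPolynomial (Fin s) k →+* k := MvPolynomial.constantCoeff
  have hPc : P = RingHom.ker c := hPm.eq_of_le (RingHom.ker_ne_top _) (by
    rw [Ideal.span_singleton_le_iff_mem, RingHom.mem_ker]; simp [c])
  have h1 : MvPolynomial.X i1 ∈ P := by rw [hPc, RingHom.mem_ker]; simp [c]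
  rw [Ideal.mem_span_singleton, MvPolynomial.X_dvd_X] at h1
  simp_all

theorem Algebra.trdeg_le_one_of_krullDimLE_one (k D : Type*) [Field k] [CommRing D]
    [IsDomain D] [Algebra k D] [Algebra.FiniteType k D] [Ring.KrullDimLE 1 D] :
    Algebra.trdeg k D ≤ 1 := by
  obtain ⟨s, g, hg, hint⟩ := exists_integral_inj_algHom_of_fg k D
  have hs := MvPolynomial.le_one_of_isIntegral_of_krullDimLE_one g.toRingHom hg hint
  let := g.toRingHom.toAlgebra
  have : IsScalarTower k (MvPolynomial (Fin s) k) D := IsScalarTower.of_algebraMap_eq fun x ↦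
    (g.commutes x).symm
  have : Algebra.IsIntegral (MvPolynomial (Fin s) k) D := ⟨hint⟩
  have : FaithfulSMul (MvPolynomial (Fin s) k) D := (faithfulSMul_iff_algebraMap_injective _ _).2 hg
  have h := lift_trdeg_add_eq k (MvPolynomial (Fin s) k) D
  rw [(trdeg_eq_zero_iff (R := MvPolynomial (Fin s) k) (A := D)).2 inferInstance,
    MvPolynomial.trdeg_of_isDomain] at h
  simp only [Cardinal.mk_fin, Cardinal.lift_natCast, Cardinal.lift_zero, add_zero] at h
  rw [← Cardinal.lift_le, ← h, Cardinal.lift_one]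
  exact_mod_cast hs

theorem Algebra.isAlgebraic_adjoin_singleton_of_transcendental {k D : Type*} [Field k] [CommRing D]
    [IsDomain D] [Algebra k D] (hD : Algebra.trdeg k D ≤ 1) {a : D} (ha : Transcendental k a) :
    Algebra.IsAlgebraic (Algebra.adjoin k {a}) D := by
  rw [← trdeg_eq_zero_iff]
  have h := trdeg_add_eq k (Algebra.adjoin k {a}) (A := D)
  have h1 : 1 ≤ Algebra.trdeg k (Algebra.adjoin k {a}) := by
    have : Algebra.Transcendental k (Algebra.adjoin k {a}) :=
      ⟨⟨⟨a, Algebra.self_mem_adjoin_singleton k a⟩, fun h ↦ ha (h.algHom (Subalgebra.val _))⟩⟩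
    exact Cardinal.one_le_iff_ne_zero.2 (trdeg_pos _ _).ne'
  have h2 := h.trans_le hD
  by_contra hne
  have h3 : 1 ≤ Algebra.trdeg (Algebra.adjoin k {a}) D := Cardinal.one_le_iff_ne_zero.2 hne
  have h4 : (1 : Cardinal) + 1 ≤ 1 := (add_le_add h1 h3).trans h2
  norm_num at h4

/-- An element fixed by a homomorphism `E : D → D[T]` cannot be transcendental if some `E y` has
positive degree: applying `E` to a relation for `y` over `k[a]` yields one for `E y`. -/
theorem isAlgebraic_of_map_eq_C {k D : Type*} [Field k] [CommRing D]
    [IsDomain D] [Algebra k D] (hD : Algebra.trdeg k D ≤ 1) (E : D →ₐ[k] D[X]) {a y : D}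
    (ha : E a = C a) (hy : (E y).natDegree ≠ 0) : IsAlgebraic k a := by
  by_contra hat
  have halg := Algebra.isAlgebraic_adjoin_singleton_of_transcendental hD hat
  obtain ⟨F, hF, hFy⟩ := halg.isAlgebraic y
  have hE : ∀ s : Algebra.adjoin k {a}, E s = C (s : D) := by
    have h : E.comp (Subalgebra.val (Algebra.adjoin k {a})) =
        (CAlgHom (R := k) (A := D)).comp (Subalgebra.val _) := by
      apply AlgHom.adjoin_ext
      rintro x hx
      obtain rfl : x = a := hx
      simpa using ha
    exact fun s ↦ DFunLike.congr_fun h s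
  have h0 : (F.map (algebraMap (Algebra.adjoin k {a}) D)).comp (E y) = 0 := by
    have h := congrArg E hFy
    rw [aeval_def, map_zero, ← AlgHom.coe_toRingHom, hom_eval₂] at h
    rw [comp, eval₂_map, ← h]
    congr 1
    ext s : 1
    exact (hE s).symm
  rw [← Polynomial.map_ne_zero_iff (FaithfulSMul.algebraMap_injective _ D)] at hF
  have h1 := natDegree_comp (p := F.map (algebraMap (Algebra.adjoin k {a}) D)) (q := E y)
  rw [h0, natDegree_zero] at h1
  rcases mul_eq_zero.1 h1.symm with h1 | h1
  · rw [natDegree_eq_zero] at h1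
    obtain ⟨c, hc⟩ := h1
    rw [← hc, C_comp, C_eq_zero] at h0
    exact hF (by rw [← hc, h0, C_0])
  · exact hy h1

/-! ### Iterative higher derivations, invariants and base change -/

namespace GaAction

section Basic

variable {R B : Type*} [CommRing R] [CommRing B] [Algebra R B] (ρ : GaAction R B)

@[ext]
theorem ext {ρ σ : GaAction R B} (h : ∀ b, ρ.exp b = σ.exp b) : ρ = σ := by
  cases ρ; cases σ
  congr
  exact AlgHom.ext h

theorem δ_zero (b : B) : ρ.δ 0 b = b := by
  rw [δ, coeff_zero_eq_eval_zero, ρ.exp_zero]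

/-- The composition law `δᵢ ∘ δⱼ = (i + j choose j) δᵢ₊ⱼ` of an iterative higher derivation. -/
theorem δ_δ (i j : ℕ) (b : B) : ρ.δ i (ρ.δ j b) = ((i + j).choose j : B) * ρ.δ (i + j) b := by
  have h := congrArg (fun q : B[X][X] ↦ (q.coeff j).coeff i) (ρ.exp_add b)
  simp only [coeff_map, RingHom.coe_coe, eval₂_eq_sum_range, finsetSum_coeff, RingHom.comp_apply,
    coeff_C_mul, coeff_X_add_C_pow] at h
  rw [δ, δ, h, Finset.sum_eq_single (i + j)]
  · rw [Nat.add_sub_cancel, coeff_mul_natCast, coeff_X_pow_self, one_mul, mul_comm, δ]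
  · intro m _ hm
    rw [coeff_mul_natCast, coeff_X_pow]
    split_ifs with hi
    · rcases lt_or_ge m j with hmj | hmj
      · simp [Nat.choose_eq_zero_of_lt hmj]
      · exact absurd (by omega) hm
    · simp
  · intro hm
    rw [coeff_eq_zero_of_natDegree_lt (by simpa using hm), zero_mul]

/-- An element is invariant if the comorphism sends it to a constant. -/
def IsInvariant (b : B) : Prop := ρ.exp b = C b

variable {ρ} in
theorem IsInvariant.δ_eq_zero {b : B} (h : ρ.IsInvariant b) {i : ℕ} (hi : 0 < i) : ρ.δ i b = 0 := by
  rw [δ, h, coeff_C_of_ne_zero hi.ne']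

theorem isInvariant_of_δ_eq_zero {b : B} (h : ∀ i, 0 < i → ρ.δ i b = 0) : ρ.IsInvariant b := by
  ext i
  rcases i.eq_zero_or_pos with rfl | hi
  · rw [coeff_C_zero]; exact ρ.δ_zero b
  · rw [coeff_C_of_ne_zero hi.ne']; exact h i hi

theorem isInvariant_iff_natDegree {b : B} : ρ.IsInvariant b ↔ (ρ.exp b).natDegree = 0 := by
  constructor
  · intro h
    rw [h, natDegree_C]
  · intro h
    exact ρ.isInvariant_of_δ_eq_zero fun i hi ↦ coeff_eq_zero_of_natDegree_lt (by omega)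

theorem natDegree_exp_δ_le (i : ℕ) (b : B) :
    (ρ.exp (ρ.δ i b)).natDegree ≤ (ρ.exp b).natDegree - i := by
  rw [natDegree_le_iff_coeff_eq_zero]
  intro j hj
  change ρ.δ j (ρ.δ i b) = 0
  rw [δ_δ, δ, coeff_eq_zero_of_natDegree_lt (by omega), mul_zero]

/-- The leading coefficient in `T` is invariant. -/
theorem isInvariant_δ_natDegree (b : B) : ρ.IsInvariant (ρ.δ (ρ.exp b).natDegree b) := by
  rw [isInvariant_iff_natDegree]
  have := ρ.natDegree_exp_δ_le (ρ.exp b).natDegree b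
  omega

/-- A minimal prime is stable under the action: the kernel of `B → (B ⧸ P)[T]` is a prime ideal
contained in `P`. -/
theorem δ_mem_of_mem_minimalPrimes {P : Ideal B} (hP : P ∈ minimalPrimes B) {b : B} (hb : b ∈ P)
    (i : ℕ) : ρ.δ i b ∈ P := by
  have hPp : P.IsPrime := hP.1.1
  let E : B →+* (B ⧸ P)[X] := (mapRingHom (Ideal.Quotient.mk P)).comp (ρ.exp : B →+* B[X])
  have hle : RingHom.ker E ≤ P := by
    intro x hx
    have h := congrArg (eval 0) (RingHom.mem_ker.1 hx)
    simp only [E, RingHom.comp_apply, coe_mapRingHom, RingHom.coe_coe, eval_zero,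
      ← coeff_zero_eq_eval_zero, coeff_map] at h
    have h0 := ρ.δ_zero x
    rw [δ] at h0
    rwa [h0, Ideal.Quotient.eq_zero_iff_mem] at h
  have h := RingHom.mem_ker.1 (hP.2 ⟨RingHom.ker_isPrime E, bot_le⟩ hle hb)
  have h := congrArg (fun q ↦ q.coeff i) h
  simp only [E, RingHom.comp_apply, coe_mapRingHom, RingHom.coe_coe, coeff_map, coeff_zero] at h
  rwa [Ideal.Quotient.eq_zero_iff_mem] at h

end Basic

section BaseChange

open TensorProduct

variable {R B : Type*} [CommRing R] [CommRing B] [Algebra R B] (ρ : GaAction R B)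
  (S : Type*) [CommRing S] [Algebra R S]

/-- The comorphism of the base change of an action along `R → S`. -/
noncomputable def baseChangeExp : S ⊗[R] B →ₐ[S] (S ⊗[R] B)[X] :=
  Algebra.TensorProduct.lift (Algebra.ofId S _)
    ((mapAlgHom (Algebra.TensorProduct.includeRight : B →ₐ[R] S ⊗[R] B)).comp ρ.exp)
    fun _ _ ↦ Commute.all _ _

theorem baseChangeExp_tmul (s : S) (b : B) : ρ.baseChangeExp S (s ⊗ₜ b) =
    C (s ⊗ₜ 1) * (ρ.exp b).map (Algebra.TensorProduct.includeRight : B →ₐ[R] S ⊗[R] B) := by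
  rw [baseChangeExp, Algebra.TensorProduct.lift_tmul]
  rfl

/-- The base change of an action along `R → S`. -/
noncomputable def baseChange : GaAction S (S ⊗[R] B) where
  exp := ρ.baseChangeExp S
  exp_zero x := by
    induction x with
    | zero => simp
    | add x y hx hy => rw [map_add, eval_add, hx, hy]
    | tmul s b =>
      have h : (ρ.exp b).coeff 0 = b := ρ.δ_zero b
      rw [baseChangeExp_tmul, eval_mul, eval_C, ← coeff_zero_eq_eval_zero, coeff_map, h]
      simp
  exp_add x := by
    induction x with
    | zero => simp
    | add x y hx hy => rw [map_add, Polynomial.map_add, hx, hy, eval₂_add]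
    | tmul s b =>
      have hs : ρ.baseChangeExp S (s ⊗ₜ 1) = C (s ⊗ₜ 1) := by simp [baseChangeExp_tmul]
      have hb : (ρ.baseChangeExp S : S ⊗[R] B →+* (S ⊗[R] B)[X]).comp
          ((Algebra.TensorProduct.includeRight : B →ₐ[R] S ⊗[R] B) : B →+* S ⊗[R] B) =
          (mapRingHom ((Algebra.TensorProduct.includeRight : B →ₐ[R] S ⊗[R] B) :
            B →+* S ⊗[R] B)).comp (ρ.exp : B →+* B[X]) := by
        ext1 x
        simp [baseChangeExp_tmul, ← Algebra.TensorProduct.one_def]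
      rw [baseChangeExp_tmul, Polynomial.map_mul, map_C, Polynomial.map_map, RingHom.coe_coe, hs,
        hb, ← Polynomial.map_map, ρ.exp_add, ← coe_mapRingHom, hom_eval₂, eval₂_mul, eval₂_C,
        eval₂_map]
      congr 1
      congr 1
      · ext1 x
        simp
      · simp

end BaseChange

/-- Invariants of a free action on a curve over a field are algebraic over the field. The curve may
be reducible and nonreduced: a minimal prime not containing some `δ i y` with `0 < i` yields a
relation for `a` modulo that prime, and some power of the product of these relations vanishes. -/
theorem isAlgebraic_of_isInvariant {k B : Type*} [Field k] [CommRing B] [Algebra k B]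
    [Algebra.FiniteType k B] (hdim : ringKrullDim B ≤ 1) (ρ : GaAction k B) (hρ : ρ.IsFree)
    {a : B} (ha : ρ.IsInvariant a) : IsAlgebraic k a := by
  have : IsNoetherianRing B := Algebra.FiniteType.isNoetherianRing k B
  have key : ∀ P ∈ minimalPrimes B, ∃ g : k[X], g ≠ 0 ∧ aeval a g ∈ P := by
    intro P hP
    have hPp : P.IsPrime := hP.1.1
    have : Ring.KrullDimLE 1 (B ⧸ P) := by
      rw [Ring.krullDimLE_iff]
      exact (ringKrullDim_quotient_le P).trans hdim
    let E : (B ⧸ P) →ₐ[k] (B ⧸ P)[X] := Ideal.Quotient.liftₐ P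
      ((mapAlgHom (Ideal.Quotient.mkₐ k P)).comp ρ.exp) (by
        intro b hb
        ext i
        simp only [AlgHom.comp_apply, coe_mapAlgHom, coeff_map, coeff_zero]
        exact Ideal.Quotient.eq_zero_iff_mem.2 (ρ.δ_mem_of_mem_minimalPrimes hP hb i))
    have hE : ∀ b, E (Ideal.Quotient.mk P b) = (ρ.exp b).map (Ideal.Quotient.mk P) :=
      fun b ↦ rfl
    -- by freeness the action on the component is not trivial
    obtain ⟨i, hi, y, hy⟩ : ∃ i, 0 < i ∧ ∃ y, ρ.δ i y ∉ P := by
      by_contra! h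
      refine hPp.ne_top (top_le_iff.1 ?_)
      rw [← hρ, Ideal.span_le]
      rintro _ ⟨i, hi, b, rfl⟩
      exact h i hi b
    have hD := Algebra.trdeg_le_one_of_krullDimLE_one k (B ⧸ P)
    obtain ⟨g, hg, hga⟩ := isAlgebraic_of_map_eq_C hD E (a := Ideal.Quotient.mk P a)
      (y := Ideal.Quotient.mk P y) (by rw [hE, ha, map_C]) (by
        have h1 : (E (Ideal.Quotient.mk P y)).coeff i ≠ 0 := by
          rw [hE, coeff_map]
          exact fun h ↦ hy (Ideal.Quotient.eq_zero_iff_mem.1 h)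
        have := le_natDegree_of_ne_zero h1
        omega)
    refine ⟨g, hg, Ideal.Quotient.eq_zero_iff_mem.1 ?_⟩
    rw [← hga, ← Ideal.Quotient.mkₐ_eq_mk k, aeval_algHom_apply]
  choose! g hg hga using key
  have hfin := minimalPrimes.finite_of_isNoetherianRing B
  have hnil : aeval a (∏ P ∈ hfin.toFinset, g P) ∈ nilradical B := by
    have h : nilradical B = sInf (minimalPrimes B) := (Ideal.sInf_minimalPrimes (I := ⊥)).symm
    rw [h, Ideal.mem_sInf]
    intro P hP
    rw [map_prod]
    exact Ideal.prod_mem P (hfin.mem_toFinset.2 hP) (hga P hP)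
  obtain ⟨N, hN⟩ := hnil
  refine ⟨(∏ P ∈ hfin.toFinset, g P) ^ N, pow_ne_zero _ (Finset.prod_ne_zero_iff.2 fun P hP ↦
    hg P (hfin.mem_toFinset.1 hP)), ?_⟩
  rw [map_pow, hN]

end GaAction

/-! ### Additivity and the additive coordinate -/

/-- An instance of Lucas' theorem: the last `s` digits of `p ^ s * q + r` in base `p` are those
of `r`. -/
theorem Nat.choose_pow_mul_add_self_modEq {p : ℕ} [Fact p.Prime] (q : ℕ) :
    ∀ {s r : ℕ}, r < p ^ s → (p ^ s * q + r).choose r ≡ 1 [MOD p]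
  | 0, r, hr => by
    obtain rfl : r = 0 := by simpa using hr
    simp [Nat.ModEq.refl]
  | s + 1, r, hr => by
    have hp : 0 < p := (Fact.out : p.Prime).pos
    refine Choose.choose_modEq_choose_mod_mul_choose_div_nat.trans ?_
    have h1 : (p ^ (s + 1) * q + r) % p = r % p := by
      rw [pow_succ', mul_assoc, Nat.mul_add_mod]
    have h2 : (p ^ (s + 1) * q + r) / p = p ^ s * q + r / p := by
      rw [pow_succ', mul_assoc, Nat.mul_add_div hp]
    rw [h1, h2, Nat.choose_self, one_mul]
    exact Nat.choose_pow_mul_add_self_modEq q (Nat.div_lt_of_lt_mul (by rwa [← pow_succ']))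

namespace GaAction

section Additive

variable {R B : Type*} [CommRing R] [CommRing B] [IsDomain B] [Algebra R B] (ρ : GaAction R B)

/-- If all higher components of `x` are invariant then only the components of index a power of the
characteristic exponent survive, because `(i choose j) δᵢ x = δⱼ (δᵢ₋ⱼ x) = 0` for `0 < j < i`. -/
theorem exists_eq_pow_of_isInvariant (p : ℕ) [ExpChar B p] {x : B}
    (hx : ∀ i, 0 < i → ρ.IsInvariant (ρ.δ i x)) {i : ℕ}
    (hi : 0 < i) (h : ρ.δ i x ≠ 0) : ∃ s, i = p ^ s := by
  have hch : ∀ j, 0 < j → j < i → ((i.choose j : ℕ) : B) = 0 := by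
    intro j hj hji
    have h1 := ρ.δ_δ (i - j) j x
    rw [(hx j hj).δ_eq_zero (by omega), Nat.sub_add_cancel hji.le] at h1
    exact (mul_eq_zero.1 h1.symm).resolve_right h
  rcases ‹ExpChar B p› with _ | hp
  · refine ⟨0, ?_⟩
    by_contra hne
    have := hch 1 one_pos (by simp at hne; omega)
    rw [Nat.choose_one_right, Nat.cast_eq_zero] at this
    omega
  · have : Fact p.Prime := ⟨hp⟩
    refine ⟨multiplicity p i, Choose.eq_pow_multiplicity_of_choose_modEq_zero_nat hi fun j hj ↦ ?_⟩
    rw [Finset.mem_Icc] at hj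
    rw [Nat.modEq_zero_iff_dvd, ← CharP.cast_eq_zero_iff B p]
    exact hch j (by omega) (by omega)

end Additive

/-- On the affine line, the degree in `T` is proportional to the degree. -/
theorem natDegree_exp {K : Type*} [Field K] (σ : GaAction K K[X]) (q : K[X]) :
    (σ.exp q).natDegree = q.natDegree * (σ.exp X).natDegree := by
  have h : σ.exp q = (q.map (C : K →+* K[X])).comp (σ.exp X) := by
    conv_lhs => rw [← aeval_X_left_apply q, ← aeval_algHom_apply]
    rw [comp, eval₂_map, aeval_def]
    rfl
  rw [h, natDegree_comp, natDegree_map]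

/-- Every action on the affine line over a field is additive: comparing degrees in `T` shows that
the components of the coordinate are constants. -/
theorem isAdditive {K : Type*} [Field K] (p : ℕ) [ExpChar K p] (σ : GaAction K K[X]) :
    σ.IsAdditive p := by
  set d := (σ.exp X).natDegree with hd
  have hconst : ∀ i, 0 < i → (σ.δ i X).natDegree = 0 := by
    intro i hi
    rcases d.eq_zero_or_pos with h0 | h0
    · rw [δ, coeff_eq_zero_of_natDegree_lt (by omega), natDegree_zero]
    · have h := σ.natDegree_exp_δ_le i X
      rw [natDegree_exp, ← hd] at h
      by_contra hne
      have := Nat.mul_le_mul_right d (Nat.one_le_iff_ne_zero.2 hne)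
      omega
  have hinv : ∀ i, 0 < i → σ.IsInvariant (σ.δ i X) := by
    intro i hi
    rw [isInvariant_iff_natDegree, natDegree_exp, hconst i hi, zero_mul]
  have hterm : ∀ j : Fin d, ∃ s : ℕ, ∃ c : K,
      C (σ.δ (j + 1) X) * X ^ ((j : ℕ) + 1) = C (C c) * X ^ p ^ s := by
    intro j
    obtain ⟨c, hc⟩ := natDegree_eq_zero.1 (hconst (j + 1) (Nat.succ_pos _))
    by_cases h0 : σ.δ (j + 1) X = 0
    · exact ⟨0, 0, by rw [h0, C_0, C_0, C_0, zero_mul, zero_mul]⟩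
    · obtain ⟨s, hs⟩ := σ.exists_eq_pow_of_isInvariant p hinv (Nat.succ_pos _) h0
      exact ⟨s, c, by rw [hc, ← hs]⟩
  choose s c hsc using hterm
  refine ⟨d, s, c, ?_⟩
  have hsum : σ.exp X = ∑ i ∈ Finset.range (d + 1), C (σ.δ i X) * X ^ i :=
    as_sum_range_C_mul_X_pow (σ.exp X)
  rw [hsum, Finset.sum_range_succ', δ_zero, pow_zero, mul_one, add_comm, Finset.sum_range]
  exact congrArg _ (Finset.sum_congr rfl fun j _ ↦ hsc j)

section Slice

variable {O B : Type*} [CommRing O] [CommRing B] [Algebra O B] (ρ : GaAction O B)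

/-- The data of an additive coordinate: an element translated by a nonzero polynomial with
coefficients in the base and generating the algebra generically. -/
structure IsSlice (b : B) (l : O[X]) : Prop where
  exp_eq : ρ.exp b = C b + l.map (algebraMap O B)
  ne_zero : l ≠ 0
  coeff_zero : l.coeff 0 = 0
  exists_smul_eq_aeval : ∀ a : B, ∃ v : O, v ≠ 0 ∧ ∃ q : O[X], v • a = aeval b q

/-- If all invariants are fractions of elements of `O`, then an element `b` of minimal positive
degree in `T` is, up to a scalar, an additive coordinate. Its components are invariant, so its
degree `n` is a power of the characteristic exponent. By Lucas' theorem `n` divides the degree of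
any other element `a`, and subtracting a multiple of a power of `b` from a multiple of `a` lowers
the degree. -/
theorem exists_isSlice [IsDomain O] [IsDomain B] [FaithfulSMul O B] (p : ℕ) [ExpChar B p]
    (hinv : ∀ a, ρ.IsInvariant a → ∃ v u : O, v ≠ 0 ∧ v • a = algebraMap O B u)
    (hne : ∃ a, ¬ ρ.IsInvariant a) : ∃ b l, ρ.IsSlice b l := by
  classical
  have hinj := FaithfulSMul.algebraMap_injective O B
  -- `b` has minimal positive degree `n` in `T`
  obtain ⟨b, hb, hmin⟩ : ∃ b, ¬ ρ.IsInvariant b ∧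
      ∀ a, (ρ.exp a).natDegree < (ρ.exp b).natDegree → ρ.IsInvariant a := by
    obtain ⟨b, hb, hmin⟩ := WellFounded.has_min (measure fun b ↦ (ρ.exp b).natDegree).wf
      {b | ¬ ρ.IsInvariant b} hne
    exact ⟨b, hb, fun a ha ↦ by_contra fun h ↦ hmin a h ha⟩
  set n := (ρ.exp b).natDegree with hn
  have hn0 : 0 < n := by
    rw [ρ.isInvariant_iff_natDegree] at hb
    omega
  have hδ : ∀ i, 0 < i → ρ.IsInvariant (ρ.δ i b) := fun i hi ↦
    hmin _ ((ρ.natDegree_exp_δ_le i b).trans_lt (by omega))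
  choose! v u hv hvu using fun i hi ↦ hinv _ (hδ i hi)
  -- a common denominator of the components of `b`
  let V : O := ∏ i ∈ Finset.range n, v (i + 1)
  have hV : V ≠ 0 := Finset.prod_ne_zero_iff.2 fun i _ ↦ hv _ (Nat.succ_pos i)
  have hVδ : ∀ i < n, ∃ w : O, V • ρ.δ (i + 1) b = algebraMap O B w := by
    intro i hi
    obtain ⟨y, hy⟩ := Finset.dvd_prod_of_mem (fun i ↦ v (i + 1)) (Finset.mem_range.2 hi)
    refine ⟨y * u (i + 1), ?_⟩
    change (∏ i ∈ Finset.range n, v (i + 1)) • _ = _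
    rw [hy, mul_comm, mul_smul, hvu _ (Nat.succ_pos i), map_mul, Algebra.smul_def]
  choose! w hw using hVδ
  let l : O[X] := ∑ i ∈ Finset.range n, C (w i) * X ^ (i + 1)
  have hexp : ρ.exp (V • b) = C (V • b) + l.map (algebraMap O B) := by
    have h0 : (ρ.exp b).coeff 0 = b := ρ.δ_zero b
    rw [map_smul]
    conv_lhs => rw [as_sum_range_C_mul_X_pow (ρ.exp b), ← hn, Finset.sum_range_succ', h0]
    rw [add_comm, smul_add, pow_zero, mul_one, smul_C, Finset.smul_sum, Polynomial.map_sum]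
    congr 1
    refine Finset.sum_congr rfl fun i hi ↦ ?_
    have h1 := hw i (Finset.mem_range.1 hi)
    rw [δ] at h1
    rw [← smul_mul_assoc, smul_C, h1]
    simp
  have hdeg : (ρ.exp (V • b)).natDegree = n := by
    rw [map_smul, ← algebraMap_smul B V (ρ.exp b), natDegree_smul _ (by simpa using hV)]
  have hlc : l.natDegree = n := by
    rw [hexp, natDegree_C_add, natDegree_map_eq_of_injective hinj] at hdeg
    exact hdeg
  have hl0 : l ≠ 0 := by
    intro h
    rw [h, natDegree_zero] at hlc
    omega
  obtain ⟨s, hs⟩ : ∃ s, n = p ^ s := by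
    refine ρ.exists_eq_pow_of_isInvariant p hδ hn0 ?_
    have : ρ.exp b ≠ 0 := by
      rintro h
      rw [h, natDegree_zero] at hn
      omega
    exact leadingCoeff_ne_zero.2 this
  refine ⟨V • b, l, hexp, hl0, by simp [l], fun a ↦ ?_⟩
  -- by induction on the degree in `T`
  induction hm : (ρ.exp a).natDegree using Nat.strong_induction_on generalizing a with
  | _ m ih =>
  rcases m.eq_zero_or_pos with rfl | hm0
  · obtain ⟨v, u, hv, h⟩ := hinv a (ρ.isInvariant_iff_natDegree.2 hm)
    exact ⟨v, hv, C u, by rw [h, aeval_C]⟩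
  have hma : ρ.δ m a ≠ 0 := by
    have : ρ.exp a ≠ 0 := by
      rintro h
      rw [h, natDegree_zero] at hm
      omega
    rw [δ, ← hm]
    exact leadingCoeff_ne_zero.2 this
  -- `n ∣ m`, as otherwise a component of `a` would have positive degree `m % n < n`
  have hnm : m % n = 0 := by
    by_contra hr
    have hrn : m % n < n := Nat.mod_lt _ hn0
    have hdm : m % n + n * (m / n) = m := Nat.mod_add_div m n
    have h1 : ρ.IsInvariant (ρ.δ (n * (m / n)) a) :=
      hmin _ ((ρ.natDegree_exp_δ_le _ a).trans_lt (by omega))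
    have h2 := ρ.δ_δ (m % n) (n * (m / n)) a
    rw [h1.δ_eq_zero (Nat.pos_of_ne_zero hr), hdm] at h2
    have h3 := (mul_eq_zero.1 h2.symm).resolve_right hma
    rw [Nat.choose_symm_of_eq_add (by rw [add_comm, hdm] : m = n * (m / n) + m % n)] at h3
    rcases ‹ExpChar B p› with _ | hp
    · rw [one_pow] at hs
      omega
    · have : Fact p.Prime := ⟨hp⟩
      have h4 := Nat.choose_pow_mul_add_self_modEq (p := p) (m / n) (s := s) (r := m % n)
        (by omega)
      rw [CharP.cast_eq_zero_iff B p] at h3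
      rw [← hs, add_comm, hdm] at h4
      exact hp.one_lt.ne' (Nat.dvd_one.1 ((Nat.modEq_zero_iff_dvd.1
        (h4.symm.trans (Nat.modEq_zero_iff_dvd.2 h3)))))
  obtain ⟨q, rfl⟩ := Nat.dvd_of_mod_eq_zero hnm
  obtain ⟨v, u, hv, hvu⟩ := hinv _ (ρ.isInvariant_δ_natDegree a)
  rw [hm] at hvu
  set c := l.leadingCoeff with hc
  have hc0 : c ≠ 0 := leadingCoeff_ne_zero.2 hl0
  -- the leading terms in `T` of the two summands cancel
  let a' := (c ^ q * v) • a - u • (V • b) ^ q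
  have hlead : (ρ.exp (V • b)).leadingCoeff = algebraMap O B c := by
    rw [leadingCoeff, hdeg, hexp, coeff_add, coeff_C_of_ne_zero hn0.ne', zero_add, coeff_map, hc,
      leadingCoeff, hlc]
  have hpw : (ρ.exp ((V • b) ^ q)).natDegree = n * q := by
    rw [map_pow, natDegree_pow, hdeg, mul_comm]
  have hpc : (ρ.exp ((V • b) ^ q)).coeff (n * q) = algebraMap O B c ^ q := by
    rw [← hpw, coeff_natDegree, map_pow, leadingCoeff_pow, hlead]
  have ha'c : (ρ.exp a').coeff (n * q) = 0 := by
    rw [δ] at hvu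
    simp only [a', map_sub, map_smul, coeff_sub, coeff_smul, hpc, mul_smul, hvu]
    simp only [Algebra.smul_def, map_pow]
    ring
  have ha'd : (ρ.exp a').natDegree ≤ n * q := by
    simp only [a', map_sub, map_smul]
    exact (natDegree_sub_le _ _).trans (max_le ((natDegree_smul_le _ _).trans hm.le)
      ((natDegree_smul_le _ _).trans hpw.le))
  have ha'lt : (ρ.exp a').natDegree < n * q := by
    refine lt_of_le_of_ne ha'd fun h ↦ ?_
    rw [← h, coeff_natDegree, leadingCoeff_eq_zero] at ha'c
    rw [ha'c, natDegree_zero] at h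
    omega
  obtain ⟨v', hv', Q, hQ⟩ := ih _ ha'lt a' rfl
  refine ⟨v' * (c ^ q * v), mul_ne_zero hv' (mul_ne_zero (pow_ne_zero _ hc0) hv),
    Q + C (v' * u) * X ^ q, ?_⟩
  have h5 : (c ^ q * v) • a = a' + u • (V • b) ^ q := by simp [a']
  rw [mul_smul, h5, smul_add, hQ, map_add, map_mul, aeval_C, map_pow, aeval_X, ← mul_smul,
    Algebra.smul_def (v' * u)]

variable {ρ} in
/-- The generator may be rescaled: `t ^ d * q(b)` is a polynomial in `t * b` for `d = deg q`. -/
theorem IsSlice.smul {b : B} {l : O[X]} [IsDomain O] (h : ρ.IsSlice b l) {t : O} (ht : t ≠ 0) :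
    ρ.IsSlice (t • b) (C t * l) where
  exp_eq := by
    rw [map_smul, h.exp_eq, smul_add, smul_C, Polynomial.map_mul, map_C, ← smul_eq_C_mul,
      algebraMap_smul]
  ne_zero := mul_ne_zero (C_ne_zero.2 ht) h.ne_zero
  coeff_zero := by rw [coeff_C_mul, h.coeff_zero, mul_zero]
  exists_smul_eq_aeval a := by
    obtain ⟨v, hv, q, hq⟩ := h.exists_smul_eq_aeval a
    refine ⟨t ^ q.natDegree * v, mul_ne_zero (pow_ne_zero _ ht) hv,
      ∑ i ∈ Finset.range (q.natDegree + 1), C (t ^ (q.natDegree - i) * q.coeff i) * X ^ i, ?_⟩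
    rw [mul_smul, hq, aeval_eq_sum_range, map_sum, Finset.smul_sum]
    refine Finset.sum_congr rfl fun i hi ↦ ?_
    have hi' : q.natDegree - i + i = q.natDegree := Nat.sub_add_cancel (by
      rw [Finset.mem_range] at hi; omega)
    nth_rw 1 [← hi']
    simp only [map_mul, aeval_C, map_pow, aeval_X, Algebra.smul_def]
    ring

theorem IsSlice.natDegree_ne_zero {b : B} {l : O[X]} (h : ρ.IsSlice b l) : l.natDegree ≠ 0 := by
  intro h0
  rw [natDegree_eq_zero] at h0
  obtain ⟨c, rfl⟩ := h0
  have := h.coeff_zero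
  rw [coeff_C_zero] at this
  exact h.ne_zero (by rw [this, C_0])

end Slice

end GaAction

/-! ### Relations over finite subalgebras and polynomials in the last variable -/

/-- A reduced Artinian ring is a product of fields. -/
theorem IsArtinianRing.isPrincipalIdealRing_polynomial (L : Type*) [CommRing L] [IsArtinianRing L]
    [IsReduced L] : IsPrincipalIdealRing L[X] := by
  let _ : ∀ i : MaximalSpectrum L, Field (L ⧸ i.asIdeal) := fun i ↦ Ideal.Quotient.field i.asIdeal
  let e := (Polynomial.mapEquiv (IsArtinianRing.equivPi L).toRingEquiv).trans
    (Polynomial.piEquiv fun i : MaximalSpectrum L ↦ L ⧸ i.asIdeal)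
  exact IsPrincipalIdealRing.of_surjective e.symm e.symm.surjective

/-- The radical of a polynomial killing `x` is squarefree, hence separable, and still kills `x`. -/
theorem IsAlgebraic.exists_separable_aeval_eq_zero {k A : Type*} [Field k] [PerfectField k]
    [CommRing A] [IsReduced A] [Algebra k A] {x : A} (hx : IsAlgebraic k x) :
    ∃ s : k[X], s.Separable ∧ aeval x s = 0 := by
  classical
  obtain ⟨g, hg, hgx⟩ := hx
  refine ⟨UniqueFactorizationMonoid.radical g,
    PerfectField.separable_iff_squarefree.2 UniqueFactorizationMonoid.squarefree_radical, ?_⟩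
  obtain ⟨N, hN⟩ := UniqueFactorizationMonoid.exists_dvd_radical_self_pow (a := g) hg
  obtain ⟨q, hq⟩ := hN
  have h : aeval x (UniqueFactorizationMonoid.radical g) ^ N = 0 := by
    rw [← map_pow, hq, map_mul, hgx, zero_mul]
  exact eq_zero_of_pow_eq_zero h

/-- The ideal of relations of an algebraic element `x` over a finite subalgebra `L` of a reduced
algebra over a perfect field is generated by one polynomial `f`, and `f' x` is a unit of `L[x]`:
`f` divides a separable polynomial over the field. -/
theorem Subalgebra.exists_relation_generator {k A : Type*} [Field k] [PerfectField k] [CommRing A]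
    [IsReduced A] [Algebra k A] (L : Subalgebra k A) [Module.Finite k L] {x : A}
    (hx : IsAlgebraic k x) :
    ∃ f : L[X], (∀ g : L[X], aeval x g = 0 ↔ f ∣ g) ∧
      ∃ w : L[X], aeval x (derivative f * w) = 1 := by
  have : IsArtinianRing L := IsArtinianRing.of_finite k L
  have : IsReduced L := isReduced_of_injective L.val Subtype.val_injective
  have := IsArtinianRing.isPrincipalIdealRing_polynomial L
  obtain ⟨f, hf⟩ :=
    (IsPrincipalIdealRing.principal (RingHom.ker (aeval x : L[X] →ₐ[L] A))).principal
  have hf' : ∀ g : L[X], aeval x g = 0 ↔ f ∣ g := by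
    intro g
    rw [← Ideal.mem_span_singleton, Ideal.span, ← hf]
    rfl
  refine ⟨f, hf', ?_⟩
  obtain ⟨s, ⟨a, c, hac⟩, hsx⟩ := hx.exists_separable_aeval_eq_zero
  obtain ⟨q, hq⟩ := (hf' (s.map (algebraMap k L))).1 (by rwa [aeval_map_algebraMap])
  have hfx : aeval x f = 0 := (hf' f).2 dvd_rfl
  refine ⟨q * c.map (algebraMap k L), ?_⟩
  have h := congrArg (fun r ↦ aeval x (r.map (algebraMap k L))) hac
  simp only [Polynomial.map_add, Polynomial.map_mul, ← derivative_map, hq, map_add, map_mul,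
    derivative_mul, hfx, Polynomial.map_one, map_one, zero_mul, mul_zero, zero_add, add_zero] at h
  rw [map_mul, map_mul, ← h]
  ring

namespace MvPolynomial

variable {O : Type*} [CommRing O]

theorem aeval_congr_of_mem_supported {σ B : Type*} [CommRing B] [Algebra O B] {b b' : σ → B}
    {s : Set σ} (h : ∀ i ∈ s, b i = b' i) {g : MvPolynomial σ O} (hg : g ∈ supported O s) :
    aeval b g = aeval b' g := by
  have hle : supported O s ≤ AlgHom.equalizer (aeval b : MvPolynomial σ O →ₐ[O] B) (aeval b') := by
    rw [supported_eq_adjoin_X, Algebra.adjoin_le_iff]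
    rintro _ ⟨i, hi, rfl⟩
    simpa using h i hi
  exact hle hg

/-- A polynomial in `X 0, …, X m` is a polynomial in `X m` over the polynomials in the preceding
variables. -/
theorem exists_polynomial_of_mem_supported_Iic {m : ℕ} {g : MvPolynomial ℕ O}
    (hg : g ∈ supported O (Set.Iic m)) :
    ∃ G : (supported O (Set.Iio m))[X], Polynomial.aeval (X m) G = g := by
  have hle : supported O (Set.Iic m) ≤ ((Polynomial.aeval (X m : MvPolynomial ℕ O) :
      (supported O (Set.Iio m))[X] →ₐ[supported O (Set.Iio m)] _).restrictScalars O).range := by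
    rw [supported_eq_adjoin_X, Algebra.adjoin_le_iff]
    rintro _ ⟨i, hi, rfl⟩
    rcases (Set.mem_Iic.1 hi).lt_or_eq with h | rfl
    · refine ⟨Polynomial.C ⟨X i, Algebra.subset_adjoin ⟨i, h, rfl⟩⟩, ?_⟩
      simp
    · exact ⟨Polynomial.X, by simp⟩
  exact hle hg

theorem aeval_X_mem_supported_Iic {m : ℕ} (G : (supported O (Set.Iio m))[X]) :
    Polynomial.aeval (X m : MvPolynomial ℕ O) G ∈ supported O (Set.Iic m) := by
  have hX : (X m : MvPolynomial ℕ O) ∈ supported O (Set.Iic m) :=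
    Algebra.subset_adjoin ⟨m, Set.mem_Iic.2 le_rfl, rfl⟩
  rw [Polynomial.aeval_eq_sum_range]
  refine Subalgebra.sum_mem _ fun i _ ↦ ?_
  rw [Algebra.smul_def]
  exact Subalgebra.mul_mem _ (supported_mono Set.Iio_subset_Iic_self (G.coeff i).2)
    (Subalgebra.pow_mem _ hX _)

theorem pderiv_aeval_X {m : ℕ} (G : (supported O (Set.Iio m))[X]) :
    pderiv m (Polynomial.aeval (X m : MvPolynomial ℕ O) G) =
      Polynomial.aeval (X m : MvPolynomial ℕ O) (Polynomial.derivative G) := by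
  induction G using Polynomial.induction_on' with
  | add p q hp hq => simp [hp, hq]
  | monomial n a =>
    have ha : pderiv m (a : MvPolynomial ℕ O) = 0 :=
      pderiv_eq_zero_of_notMem_vars fun h ↦ lt_irrefl m (mem_supported.1 a.2 h)
    have hcoe (c : supported O (Set.Iio m)) : algebraMap _ (MvPolynomial ℕ O) c = c := rfl
    rw [Polynomial.derivative_monomial, Polynomial.aeval_monomial, Polynomial.aeval_monomial,
      hcoe, hcoe, pderiv_mul, ha, pderiv_pow, pderiv_X_self]
    push_cast
    ring

/-- First order Taylor expansion along the last variable. -/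
theorem map_eq_add_pderiv_mul {m : ℕ} {Q : Type*} [CommRing Q] [Algebra O Q]
    {φ φ' : MvPolynomial ℕ O →ₐ[O] Q} {h : Q} (hlt : ∀ j < m, φ' (X j) = φ (X j))
    (hm : φ' (X m) = φ (X m) + h) (hh : h * h = 0) {g : MvPolynomial ℕ O}
    (hg : g ∈ supported O (Set.Iic m)) : φ' g = φ g + φ (pderiv m g) * h := by
  rw [supported_eq_adjoin_X] at hg
  induction hg using Algebra.adjoin_induction with
  | mem x hx =>
    obtain ⟨j, hj, rfl⟩ := hx
    rcases (Set.mem_Iic.1 hj).lt_or_eq with hjm | rfl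
    · rw [pderiv_X_of_ne hjm.ne, hlt j hjm, map_zero, zero_mul, add_zero]
    · rw [pderiv_X_self, hm, map_one, one_mul]
  | algebraMap r => simp
  | add x y _ _ hx hy => simp only [map_add, hx, hy]; ring
  | mul x y _ _ hx hy =>
    simp only [pderiv_mul, map_add, map_mul, hx, hy]
    linear_combination φ (pderiv m x) * φ (pderiv m y) * hh

end MvPolynomial

/-! ### Towers of dilatations -/

namespace MvPolynomial

variable {O : Type*} [CommRing O]

/-- The ideal `(t, f₀, …, fₘ₋₁)` in a polynomial ring with infinitely many variables. -/
noncomputable def towerIdeal (t : O) (f : ℕ → MvPolynomial ℕ O) (m : ℕ) :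
    Ideal (MvPolynomial ℕ O) :=
  Ideal.span ({C t} ∪ f '' Set.Iio m)

theorem C_mem_towerIdeal (t : O) (f : ℕ → MvPolynomial ℕ O) (m : ℕ) : C t ∈ towerIdeal t f m :=
  Ideal.subset_span (Or.inl rfl)

theorem mem_towerIdeal {t : O} {f : ℕ → MvPolynomial ℕ O} {i m : ℕ} (h : i < m) :
    f i ∈ towerIdeal t f m :=
  Ideal.subset_span (Or.inr ⟨i, h, rfl⟩)

theorem towerIdeal_mono (t : O) (f : ℕ → MvPolynomial ℕ O) {m n : ℕ} (h : m ≤ n) :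
    towerIdeal t f m ≤ towerIdeal t f n :=
  Ideal.span_mono (Set.union_subset_union_right _ (Set.image_mono (Set.Iio_subset_Iio h)))

theorem towerIdeal_congr {t : O} {f f' : ℕ → MvPolynomial ℕ O} {m : ℕ}
    (h : ∀ i < m, f i = f' i) : towerIdeal t f m = towerIdeal t f' m := by
  have : f '' Set.Iio m = f' '' Set.Iio m := Set.image_congr h
  rw [towerIdeal, towerIdeal, this]

theorem pderiv_mem_supported_Iic {p : MvPolynomial ℕ O} {i : ℕ} (hp : p ∈ supported O (Set.Iic i)) :
    pderiv i p ∈ supported O (Set.Iic i) := by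
  obtain ⟨P, rfl⟩ := exists_polynomial_of_mem_supported_Iic hp
  rw [pderiv_aeval_X]
  exact aeval_X_mem_supported_Iic _

end MvPolynomial

open MvPolynomial (supported towerIdeal pderiv)

section Tower

variable {O B A : Type*} [CommRing O] [CommRing B] [CommRing A] [Algebra O B] [Algebra O A]

/-- A sequence of `m` successive dilatations inside `B`: elements `b 0, …, b m` of `B` with
`t * b (i + 1) = f i (b 0, …, b i)`, where `f i` is étale in its last variable modulo `t`, and
`t, f 0, …, f (i - 1)` generate the relations between `b 0, …, b (i - 1)` in the special fibre,
which is given as a homomorphism `π : B → A`. Only the `f i` with `i < m` and the `b j` with `j ≤ m`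
matter; indexing by `ℕ` lets the sequences be prolonged one term at a time. -/
structure IsDilatationTower (t : O) (π : B →ₐ[O] A) (f : ℕ → MvPolynomial ℕ O) (b : ℕ → B)
    (m : ℕ) : Prop where
  mem_supported : ∀ i < m, f i ∈ supported O (Set.Iic i)
  smul_eq : ∀ i < m, t • b (i + 1) = MvPolynomial.aeval b (f i)
  exists_inverse : ∀ i < m, ∃ w ∈ supported O (Set.Iic i),
    π (MvPolynomial.aeval b (pderiv i (f i) * w)) = 1
  mem_towerIdeal : ∀ i ≤ m, ∀ g ∈ supported O (Set.Iio i),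
    π (MvPolynomial.aeval b g) = 0 → g ∈ towerIdeal t f i

namespace IsDilatationTower

theorem update {t : O} {π : B →ₐ[O] A} {f : ℕ → MvPolynomial ℕ O} {b : ℕ → B} {m : ℕ}
    (h : IsDilatationTower t π f b m) {g : MvPolynomial ℕ O} {c : B}
    (hg : g ∈ supported O (Set.Iic m)) (hc : t • c = MvPolynomial.aeval b g)
    (hinv : ∃ w ∈ supported O (Set.Iic m), π (MvPolynomial.aeval b (pderiv m g * w)) = 1)
    (hmem : ∀ p ∈ supported O (Set.Iic m), π (MvPolynomial.aeval b p) = 0 →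
      p ∈ towerIdeal t (Function.update f m g) (m + 1)) :
    IsDilatationTower t π (Function.update f m g) (Function.update b (m + 1) c) (m + 1) := by
  have hbi : ∀ i ≤ m, Function.update b (m + 1) c i = b i := fun i hi ↦
    Function.update_of_ne (by omega) c b
  have hb : ∀ {p : MvPolynomial ℕ O}, p ∈ supported O (Set.Iic m) →
      MvPolynomial.aeval (Function.update b (m + 1) c) p = MvPolynomial.aeval b p := fun hp ↦
    MvPolynomial.aeval_congr_of_mem_supported (fun i hi ↦ hbi i (Set.mem_Iic.1 hi)) hp
  have hfi : ∀ i < m, Function.update f m g i = f i := fun i hi ↦ Function.update_of_ne hi.ne _ _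
  have hIic : ∀ {i}, i ≤ m → supported O (Set.Iic i) ≤ supported O (Set.Iic m) := fun hi ↦
    MvPolynomial.supported_mono (Set.Iic_subset_Iic.2 hi)
  constructor
  · intro i hi
    rcases (Nat.lt_succ_iff.1 hi).lt_or_eq with hi | rfl
    · rw [hfi i hi]
      exact h.mem_supported i hi
    · rwa [Function.update_self]
  · intro i hi
    rcases (Nat.lt_succ_iff.1 hi).lt_or_eq with hi | rfl
    · rw [hfi i hi, hb (hIic hi.le (h.mem_supported i hi)), Function.update_of_ne (by omega),
        h.smul_eq i hi]
    · rw [Function.update_self, Function.update_self, hb hg, hc]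
  · intro i hi
    rcases (Nat.lt_succ_iff.1 hi).lt_or_eq with hi | rfl
    · obtain ⟨w, hw, h1⟩ := h.exists_inverse i hi
      refine ⟨w, hw, ?_⟩
      rw [hfi i hi, hb (hIic hi.le (Subalgebra.mul_mem _
        (MvPolynomial.pderiv_mem_supported_Iic (h.mem_supported i hi)) hw)), h1]
    · obtain ⟨w, hw, h1⟩ := hinv
      refine ⟨w, hw, ?_⟩
      rw [Function.update_self, hb (Subalgebra.mul_mem _
        (MvPolynomial.pderiv_mem_supported_Iic hg) hw), h1]
  · intro i hi p hp hp0
    rcases hi.lt_or_eq with hi | rfl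
    · have hi' := Nat.lt_succ_iff.1 hi
      rw [MvPolynomial.towerIdeal_congr fun j hj ↦ hfi j (hj.trans_le hi')]
      rw [hb (MvPolynomial.supported_mono (fun x hx ↦ by
        rw [Set.mem_Iio] at hx; rw [Set.mem_Iic]; omega) hp)] at hp0
      exact h.mem_towerIdeal i hi' p hp hp0
    · have hp : p ∈ supported O (Set.Iic m) := by
        rwa [show Set.Iic m = Set.Iio (m + 1) by ext; simp]
      rw [hb hp] at hp0
      exact hmem p hp hp0

end IsDilatationTower

variable {k : Type*} [Field k] [Algebra k A]

section Image

variable (k) in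
/-- The subalgebra generated by the images of `b 0, …, b (m - 1)` in the special fibre. -/
def imageSubalgebra (π : B →ₐ[O] A) (b : ℕ → B) (m : ℕ) : Subalgebra k A :=
  Algebra.adjoin k ((fun j ↦ π (b j)) '' Set.Iio m)

theorem finite_imageSubalgebra (π : B →ₐ[O] A) (b : ℕ → B) (m : ℕ)
    (h : ∀ j < m, IsAlgebraic k (π (b j))) : Module.Finite k (imageSubalgebra k π b m) := by
  refine Module.Finite.iff_fg.2 (fg_adjoin_of_finite ((Set.finite_Iio m).image _) ?_)
  rintro _ ⟨j, hj, rfl⟩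
  exact (h j hj).isIntegral

variable [Algebra O k] [IsScalarTower O k A]

theorem map_aeval_mem_imageSubalgebra (π : B →ₐ[O] A) (b : ℕ → B) {m : ℕ} {g : MvPolynomial ℕ O}
    (hg : g ∈ supported O (Set.Iio m)) :
    π (MvPolynomial.aeval b g) ∈ imageSubalgebra k π b m := by
  have hle : supported O (Set.Iio m) ≤ ((imageSubalgebra k π b m).restrictScalars O).comap
      (π.comp (MvPolynomial.aeval b)) := by
    rw [MvPolynomial.supported_eq_adjoin_X, Algebra.adjoin_le_iff]
    rintro _ ⟨i, hi, rfl⟩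
    have h : π (b i) ∈ imageSubalgebra k π b m :=
      Algebra.subset_adjoin (Set.mem_image_of_mem (fun j ↦ π (b j)) hi)
    rwa [SetLike.mem_coe, Subalgebra.mem_comap, AlgHom.comp_apply, MvPolynomial.aeval_X,
      Subalgebra.mem_restrictScalars]
  exact hle hg

variable (k) in
/-- Evaluation of polynomials in the first `m` variables at `b` in the special fibre. -/
noncomputable def evalImage (π : B →ₐ[O] A) (b : ℕ → B) (m : ℕ) :
    supported O (Set.Iio m) →+* imageSubalgebra k π b m :=
  RingHom.codRestrict (((π.comp (MvPolynomial.aeval b)).comp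
    (supported O (Set.Iio m)).val : _ →ₐ[O] A) : supported O (Set.Iio m) →+* A)
    (imageSubalgebra k π b m) fun g ↦ map_aeval_mem_imageSubalgebra π b g.2

theorem coe_evalImage (π : B →ₐ[O] A) (b : ℕ → B) (m : ℕ) (g : supported O (Set.Iio m)) :
    (evalImage k π b m g : A) = π (MvPolynomial.aeval b (g : MvPolynomial ℕ O)) := rfl

theorem evalImage_surjective (hk : Function.Surjective (algebraMap O k)) (π : B →ₐ[O] A)
    (b : ℕ → B) (m : ℕ) : Function.Surjective (evalImage k π b m) := by
  rintro ⟨x, hx⟩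
  suffices ∃ g ∈ supported O (Set.Iio m), π (MvPolynomial.aeval b g) = x by
    obtain ⟨g, hg, rfl⟩ := this
    exact ⟨⟨g, hg⟩, rfl⟩
  induction hx using Algebra.adjoin_induction with
  | mem x hx =>
    obtain ⟨j, hj, rfl⟩ := hx
    exact ⟨MvPolynomial.X j, Algebra.subset_adjoin ⟨j, hj, rfl⟩, by simp⟩
  | algebraMap r =>
    obtain ⟨r, rfl⟩ := hk r
    refine ⟨algebraMap O _ r, Subalgebra.algebraMap_mem _ _, ?_⟩
    rw [AlgHom.commutes, AlgHom.commutes, ← IsScalarTower.algebraMap_apply]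
  | add x y _ _ hx hy =>
    obtain ⟨g, hg, rfl⟩ := hx
    obtain ⟨h, hh, rfl⟩ := hy
    exact ⟨g + h, Subalgebra.add_mem _ hg hh, by simp⟩
  | mul x y _ _ hx hy =>
    obtain ⟨g, hg, rfl⟩ := hx
    obtain ⟨h, hh, rfl⟩ := hy
    exact ⟨g * h, Subalgebra.mul_mem _ hg hh, by simp⟩

theorem map_aeval_aeval_X (π : B →ₐ[O] A) (b : ℕ → B) (m : ℕ) (G : (supported O (Set.Iio m))[X]) :
    π (MvPolynomial.aeval b (aeval (MvPolynomial.X m : MvPolynomial ℕ O) G)) =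
      aeval (π (b m)) (G.map (evalImage k π b m)) := by
  rw [aeval_eq_sum_range, aeval_def, eval₂_map, eval₂_eq_sum_range, map_sum, map_sum]
  refine Finset.sum_congr rfl fun i _ ↦ ?_
  rw [Algebra.smul_def, map_mul, map_mul, map_pow, map_pow, MvPolynomial.aeval_X]
  rfl

end Image

namespace IsDilatationTower

variable {t : O} {π : B →ₐ[O] A} {f : ℕ → MvPolynomial ℕ O} {b : ℕ → B} {m : ℕ}
  [Algebra O k] [IsScalarTower O k A]

/-- Polynomials in the last variable with congruent coefficients in the special fibre are congruent
modulo the ideal of the tower. -/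
theorem aeval_X_sub_mem_towerIdeal (h : IsDilatationTower t π f b m)
    {G H : (supported O (Set.Iio m))[X]}
    (hGH : G.map (evalImage k π b m) = H.map (evalImage k π b m)) :
    aeval (MvPolynomial.X m : MvPolynomial ℕ O) G -
      aeval (MvPolynomial.X m : MvPolynomial ℕ O) H ∈ towerIdeal t f m := by
  rw [aeval_eq_sum_range' (Nat.lt_succ_of_le (le_max_left G.natDegree H.natDegree)),
    aeval_eq_sum_range' (Nat.lt_succ_of_le (le_max_right G.natDegree H.natDegree)),
    ← Finset.sum_sub_distrib]
  refine Ideal.sum_mem _ fun i _ ↦ ?_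
  rw [Algebra.smul_def, Algebra.smul_def, ← sub_mul]
  refine Ideal.mul_mem_right _ _ (h.mem_towerIdeal m le_rfl _
    (Subalgebra.sub_mem _ (G.coeff i).2 (H.coeff i).2) ?_)
  have := congrArg (fun q ↦ ((q.coeff i : imageSubalgebra k π b m) : A)) hGH
  simp only [coeff_map, coe_evalImage] at this
  rw [map_sub, map_sub, sub_eq_zero]
  exact this

/-- If `F` generates the relations of the last element over the preceding ones in the special fibre,
then adding `F` to the ideal of the tower yields all relations between the elements. -/
theorem mem_towerIdeal_of_generator (hk : Function.Surjective (algebraMap O k))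
    (h : IsDilatationTower t π f b m) {F : (supported O (Set.Iio m))[X]}
    (hF : ∀ g : (imageSubalgebra k π b m)[X], aeval (π (b m)) g = 0 →
      F.map (evalImage k π b m) ∣ g) {I : Ideal (MvPolynomial ℕ O)} (hI : towerIdeal t f m ≤ I)
    (hFI : aeval (MvPolynomial.X m : MvPolynomial ℕ O) F ∈ I) {p : MvPolynomial ℕ O}
    (hp : p ∈ supported O (Set.Iic m)) (hp0 : π (MvPolynomial.aeval b p) = 0) : p ∈ I := by
  obtain ⟨P, rfl⟩ := MvPolynomial.exists_polynomial_of_mem_supported_Iic hp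
  rw [map_aeval_aeval_X (k := k)] at hp0
  obtain ⟨q, hq⟩ := hF _ hp0
  obtain ⟨q, rfl⟩ := Polynomial.map_surjective _ (evalImage_surjective hk π b m) q
  have h1 := h.aeval_X_sub_mem_towerIdeal (k := k) (G := P) (H := F * q) (by
    rw [Polynomial.map_mul, hq])
  have h2 := I.add_mem (hI h1) (I.mul_mem_right
    (aeval (MvPolynomial.X m : MvPolynomial ℕ O) q) hFI)
  rwa [map_mul, sub_add_cancel] at h2

variable (k) in
/-- One more dilatation, whenever the last element is algebraic in the special fibre. -/
theorem exists_succ [PerfectField k] [IsReduced A]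
    (hk : Function.Surjective (algebraMap O k)) (hπ : ∀ x, π x = 0 → ∃ c, x = t • c)
    (h : IsDilatationTower t π f b m) (halg : ∀ j ≤ m, IsAlgebraic k (π (b j))) :
    ∃ g c, IsDilatationTower t π (Function.update f m g) (Function.update b (m + 1) c) (m + 1) := by
  have := finite_imageSubalgebra π b m fun j hj ↦ halg j hj.le
  obtain ⟨F, hF, W, hW⟩ := (imageSubalgebra k π b m).exists_relation_generator (halg m le_rfl)
  have hsurj := Polynomial.map_surjective _ (evalImage_surjective hk π b m)
  obtain ⟨F, rfl⟩ := hsurj F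
  obtain ⟨W, rfl⟩ := hsurj W
  have hF0 : π (MvPolynomial.aeval b (aeval (MvPolynomial.X m : MvPolynomial ℕ O) F)) = 0 := by
    rw [map_aeval_aeval_X (k := k)]
    exact (hF _).2 dvd_rfl
  obtain ⟨c, hc⟩ := hπ _ hF0
  refine ⟨_, c, h.update (MvPolynomial.aeval_X_mem_supported_Iic F) hc.symm
    ⟨aeval (MvPolynomial.X m : MvPolynomial ℕ O) W,
      MvPolynomial.aeval_X_mem_supported_Iic W, ?_⟩ fun p hp hp0 ↦
    h.mem_towerIdeal_of_generator hk (fun g ↦ (hF g).1) ?_ ?_ hp hp0⟩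
  · rw [MvPolynomial.pderiv_aeval_X, ← map_mul, map_aeval_aeval_X (k := k), ← hW,
      Polynomial.map_mul, derivative_map]
  · refine le_trans (MvPolynomial.towerIdeal_congr fun i hi ↦
      (Function.update_of_ne (Nat.ne_of_lt hi) _ _).symm).le
      (MvPolynomial.towerIdeal_mono _ _ (Nat.le_succ m))
  · have := MvPolynomial.mem_towerIdeal (t := t) (f := Function.update f m
      (aeval (MvPolynomial.X m : MvPolynomial ℕ O) F)) (Nat.lt_succ_self m)
    rwa [Function.update_self] at this

end IsDilatationTower

end Tower

/-! ### Translations along a tower -/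

section Translation

variable {O B A : Type*} [CommRing O] [CommRing B] [CommRing A] [Algebra O B] [Algebra O A]

/-- The action translates `x` by `t ^ e` times a polynomial which, in the special fibre, is a unit
multiple of the fixed polynomial `l`. -/
def IsTranslatedBy (ρ : GaAction O B) (π : B →ₐ[O] A) (t : O) (l : O[X]) (e : ℕ) (x : B) : Prop :=
  ∃ (q : B[X]) (u : B), ρ.exp x = C x + t ^ e • q ∧
    q.map (π : B →+* A) = C (π u) * l.map (algebraMap O A) ∧ IsUnit (π u)

/-- A dilatation lowers the power of `t` in the translation of the last variable by one: modulo
`t ^ (e + 1)` the polynomial `g` is translated by `∂g` times the translation of its last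
variable. -/
theorem IsTranslatedBy.succ [IsDomain B] [FaithfulSMul O B] {ρ : GaAction O B}
    {π : B →ₐ[O] A} {t : O} {l : O[X]} {n i : ℕ} {b : ℕ → B} {g : MvPolynomial ℕ O}
    (ht : t ≠ 0) (htA : algebraMap O A t = 0) (hi : i < n)
    (h : ∀ j ≤ i, IsTranslatedBy ρ π t l (n - j) (b j)) (hg : g ∈ supported O (Set.Iic i))
    (hb : t • b (i + 1) = MvPolynomial.aeval b g)
    (hinv : ∃ w ∈ supported O (Set.Iic i), π (MvPolynomial.aeval b (pderiv i g * w)) = 1) :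
    IsTranslatedBy ρ π t l (n - (i + 1)) (b (i + 1)) := by
  obtain ⟨e, rfl⟩ : ∃ e, n = i + 1 + e := ⟨n - (i + 1), by omega⟩
  obtain ⟨q, u, hq, hqu, hu⟩ := h i le_rfl
  rw [show i + 1 + e - i = e + 1 by omega] at hq
  rw [show i + 1 + e - (i + 1) = e by omega]
  set D := MvPolynomial.aeval b (pderiv i g) with hD
  -- the square of the translation of the last variable vanishes modulo `t ^ (e + 2)`
  let J : Ideal B[X] := Ideal.span {algebraMap O B[X] (t ^ (e + 2))}
  have hJ : ∀ (j : ℕ) (x : B[X]), e + 2 ≤ j → t ^ j • x ∈ J := by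
    intro j x hj
    rw [Ideal.mem_span_singleton, Algebra.smul_def]
    obtain ⟨c, rfl⟩ := Nat.exists_eq_add_of_le hj
    exact ⟨algebraMap O B[X] (t ^ c) * x, by rw [pow_add, map_mul, mul_assoc]⟩
  let φ : MvPolynomial ℕ O →ₐ[O] B[X] ⧸ J :=
    (Ideal.Quotient.mkₐ O J).comp ((CAlgHom (R := O) (A := B)).comp (MvPolynomial.aeval b))
  let φ' : MvPolynomial ℕ O →ₐ[O] B[X] ⧸ J :=
    (Ideal.Quotient.mkₐ O J).comp (ρ.exp.comp (MvPolynomial.aeval b))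
  have hφ : ∀ p, φ p = Ideal.Quotient.mk J (C (MvPolynomial.aeval b p)) := fun p ↦ rfl
  have hφ' : ∀ p, φ' p = Ideal.Quotient.mk J (ρ.exp (MvPolynomial.aeval b p)) := fun p ↦ rfl
  have key : φ' g = φ g + φ (pderiv i g) * Ideal.Quotient.mk J (t ^ (e + 1) • q) := by
    refine MvPolynomial.map_eq_add_pderiv_mul ?_ ?_ ?_ hg
    · intro j hj
      obtain ⟨q', u', hq', -⟩ := h j hj.le
      rw [hφ, hφ', MvPolynomial.aeval_X, hq', map_add,
        Ideal.Quotient.eq_zero_iff_mem.2 (hJ _ q' (by omega)), add_zero]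
    · rw [hφ, hφ', MvPolynomial.aeval_X, hq, map_add]
    · rw [← map_mul, Ideal.Quotient.eq_zero_iff_mem, smul_mul_smul_comm, ← pow_add]
      exact hJ _ _ (by omega)
  rw [hφ, hφ, hφ', ← map_mul, ← map_add, ← hD, Ideal.Quotient.eq, Ideal.mem_span_singleton,
    ← hb] at key
  obtain ⟨r, hr⟩ := key
  rw [← Algebra.smul_def] at hr
  refine ⟨C D * q + t • r, D * u, ?_, ?_, ?_⟩
  · have ht' : algebraMap O B t ≠ 0 := by
      rwa [Ne, FaithfulSMul.algebraMap_eq_zero_iff]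
    have hcancel : Function.Injective (fun x : B[X] ↦ t • x) := by
      intro x y hxy
      simp only [← algebraMap_smul B t, smul_eq_C_mul] at hxy
      exact mul_left_cancel₀ (C_ne_zero.2 ht') hxy
    apply hcancel
    simp only [map_smul] at hr
    rw [sub_eq_iff_eq_add] at hr
    simp only [hr, ← smul_C, smul_add, pow_succ, mul_smul_comm, mul_smul]
    rw [smul_comm t (t ^ e) (C D * q), smul_comm t (t ^ e) (t • r)]
    abel
  · rw [Polynomial.map_add, Polynomial.map_mul, map_C, hqu]
    have : (t • r).map (π : B →+* A) = 0 := by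
      rw [← algebraMap_smul B t r, Polynomial.map_smul]
      simp [htA]
    rw [this, add_zero, ← mul_assoc, RingHom.coe_coe, map_mul π, C_mul]
  · obtain ⟨w, -, hw⟩ := hinv
    rw [map_mul]
    refine IsUnit.mul (IsUnit.of_mul_eq_one (π (MvPolynomial.aeval b w)) ?_) hu
    rw [← map_mul, hD, ← map_mul, hw]

/-- Elements translated by a multiple of `t` are invariant in the special fibre. -/
theorem IsTranslatedBy.map_exp {ρ : GaAction O B} {π : B →ₐ[O] A} {t : O} {l : O[X]} {e : ℕ} {x : B}
    (h : IsTranslatedBy ρ π t l e x) (htA : algebraMap O A t = 0) (he : e ≠ 0) :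
    (ρ.exp x).map (π : B →+* A) = C (π x) := by
  obtain ⟨q, u, hq, -⟩ := h
  rw [hq, ← algebraMap_smul B (t ^ e) q, Polynomial.map_add, Polynomial.map_smul]
  simp [htA, he]

end Translation

section Existence

variable {O B A k : Type*} [CommRing O] [CommRing B] [CommRing A] [Algebra O B]
  [Algebra O A] [Field k] [Algebra k A] [Algebra O k] [IsScalarTower O k A]

variable (k) in
/-- Dilatations can be iterated as long as the translation of the last variable is divisible
by `t`. -/
theorem exists_isDilatationTower [IsDomain B] [FaithfulSMul O B] [PerfectField k] [IsReduced A]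
    [Nontrivial A]
    {ρ : GaAction O B} {π : B →ₐ[O] A} {t : O} (ht : t ≠ 0)
    (hk : Function.Surjective (algebraMap O k)) (htk : ∀ r, algebraMap O k r = 0 ↔ t ∣ r)
    (hπ : ∀ x, π x = 0 → ∃ c, x = t • c)
    (halg : ∀ x, (ρ.exp x).map (π : B →+* A) = C (π x) → IsAlgebraic k (π x))
    {l : O[X]} {n : ℕ} {x : B} (hx : ρ.exp x = C x + t ^ n • l.map (algebraMap O B)) :
    ∀ m ≤ n, ∃ f b, b 0 = x ∧ IsDilatationTower t π f b m ∧
      ∀ j ≤ m, IsTranslatedBy ρ π t l (n - j) (b j) := by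
  have htA : algebraMap O A t = 0 := by
    rw [IsScalarTower.algebraMap_apply O k A, (htk t).2 dvd_rfl, map_zero]
  intro m
  induction m with
  | zero =>
    intro _
    refine ⟨0, fun _ ↦ x, rfl, ⟨by simp, by simp, by simp, ?_⟩, ?_⟩
    · intro i hi g hg hg0
      obtain rfl : i = 0 := by omega
      rw [show Set.Iio 0 = (∅ : Set ℕ) by ext; simp, MvPolynomial.supported_empty,
        Algebra.mem_bot] at hg
      obtain ⟨r, rfl⟩ := hg
      rw [AlgHom.commutes, AlgHom.commutes, IsScalarTower.algebraMap_apply O k A,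
        FaithfulSMul.algebraMap_eq_zero_iff, htk] at hg0
      obtain ⟨s, rfl⟩ := hg0
      rw [map_mul]
      exact Ideal.mul_mem_right _ _ (MvPolynomial.C_mem_towerIdeal t 0 0)
    · intro j hj
      obtain rfl : j = 0 := by omega
      refine ⟨l.map (algebraMap O B), 1, hx, ?_, by simp⟩
      rw [Polynomial.map_map, map_one, C_1, one_mul]
      congr 1
      ext r
      simp
  | succ m ih =>
    intro hm
    obtain ⟨f, b, hb0, hT, htr⟩ := ih (Nat.le_of_succ_le hm)
    have halg' : ∀ j ≤ m, IsAlgebraic k (π (b j)) := fun j hj ↦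
      halg _ ((htr j hj).map_exp htA (by omega))
    obtain ⟨g, c, hT'⟩ := hT.exists_succ k hk hπ halg'
    have hb : ∀ j ≤ m, Function.update b (m + 1) c j = b j := fun j hj ↦
      Function.update_of_ne (by omega) c b
    have htr' : ∀ j ≤ m, IsTranslatedBy ρ π t l (n - j) (Function.update b (m + 1) c j) := by
      intro j hj
      rw [hb j hj]
      exact htr j hj
    refine ⟨_, _, (hb 0 (Nat.zero_le _)).trans hb0, hT', fun j hj ↦ ?_⟩
    rcases hj.lt_or_eq with hj | rfl
    · exact htr' j (Nat.lt_succ_iff.1 hj)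
    · exact IsTranslatedBy.succ ht htA hm htr' (hT'.mem_supported m (Nat.lt_succ_self m))
        (hT'.smul_eq m (Nat.lt_succ_self m)) (hT'.exists_inverse m (Nat.lt_succ_self m))

/-- At the end of the tower the last variable is transcendental over the preceding ones in the
special fibre, as its translation does not vanish there. -/
theorem IsDilatationTower.mem_towerIdeal_of_isTranslatedBy [Nontrivial A]
    {ρ : GaAction O B} {π : B →ₐ[O] A} {t : O} (htk : algebraMap O k t = 0)
    (hπ : ∀ x, π x = 0 → ∃ c, x = t • c) {l : O[X]} (hl : (l.map (algebraMap O k)).natDegree ≠ 0)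
    {f : ℕ → MvPolynomial ℕ O} {b : ℕ → B} {n : ℕ} (hT : IsDilatationTower t π f b n)
    (htr : ∀ j ≤ n, IsTranslatedBy ρ π t l (n - j) (b j)) {g : MvPolynomial ℕ O}
    (hg : g ∈ supported O (Set.Iic n)) (hg0 : π (MvPolynomial.aeval b g) = 0) :
    g ∈ towerIdeal t f n := by
  have htA : algebraMap O A t = 0 := by
    rw [IsScalarTower.algebraMap_apply O k A, htk, map_zero]
  let E : B →ₐ[O] A[X] := (mapAlgHom π).comp ρ.exp
  have hE : ∀ x, E x = (ρ.exp x).map (π : B →+* A) := fun x ↦ rfl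
  -- the variables before the last one are invariant in the special fibre
  have hES : ∀ s ∈ supported O (Set.Iio n), E (MvPolynomial.aeval b s) =
      C (π (MvPolynomial.aeval b s)) := by
    have hle : supported O (Set.Iio n) ≤ AlgHom.equalizer (E.comp (MvPolynomial.aeval b))
        ((CAlgHom (R := O) (A := A)).comp (π.comp (MvPolynomial.aeval b))) := by
      rw [MvPolynomial.supported_eq_adjoin_X, Algebra.adjoin_le_iff]
      rintro _ ⟨j, hj, rfl⟩
      rw [Set.mem_Iio] at hj
      have h1 : E (b j) = C (π (b j)) := (htr j hj.le).map_exp htA (by omega)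
      simpa using h1
    exact fun s hs ↦ hle hs
  obtain ⟨q, u, hq, hqu, hu⟩ := htr n le_rfl
  set Q : A[X] := C (π (b n)) + C (π u) * l.map (algebraMap O A) with hQ
  have hEn : E (b n) = Q := by
    rw [hE, hq, Nat.sub_self, pow_zero, one_smul, Polynomial.map_add, hqu, map_C]
    rfl
  set d := (l.map (algebraMap O k)).natDegree with hd
  have hlA : l.map (algebraMap O A) = (l.map (algebraMap O k)).map (algebraMap k A) := by
    rw [Polynomial.map_map, ← IsScalarTower.algebraMap_eq]
  have hQd : Q.natDegree ≤ d := by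
    rw [hQ, natDegree_C_add]
    refine (natDegree_C_mul_le _ _).trans ?_
    rw [hlA]
    exact natDegree_map_le
  have hQc : IsUnit (Q.coeff d) := by
    rw [hQ, coeff_add, coeff_C_of_ne_zero hl, zero_add, coeff_C_mul, hlA, coeff_map]
    refine hu.mul (IsUnit.map _ (IsUnit.mk0 _ ?_))
    rw [hd, coeff_natDegree, leadingCoeff_ne_zero]
    rintro h
    rw [hd, h, natDegree_zero] at hl
    exact hl rfl
  have hQdeg : Q.natDegree = d := le_antisymm hQd (le_natDegree_of_ne_zero hQc.ne_zero)
  obtain ⟨G, rfl⟩ := MvPolynomial.exists_polynomial_of_mem_supported_Iic hg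
  -- as a polynomial in the last variable, `g` is `P`, and comparing leading coefficients in `T` in
  -- `P (Q(T)) = 0` gives `P = 0`
  let P : A[X] := (G.map (evalImage k π b n)).map (imageSubalgebra k π b n).val.toRingHom
  have hPQ : P.comp Q = 0 := by
    have h1 : E (MvPolynomial.aeval b (aeval (MvPolynomial.X n : MvPolynomial ℕ O) G)) =
        P.comp Q := by
      rw [aeval_eq_sum_range, comp, eval₂_map, eval₂_map, eval₂_eq_sum_range, map_sum, map_sum]
      refine Finset.sum_congr rfl fun i _ ↦ ?_
      rw [Algebra.smul_def, map_mul, map_mul, map_pow, map_pow, MvPolynomial.aeval_X, hEn]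
      congr 1
      exact hES _ (G.coeff i).2
    obtain ⟨c, hc⟩ := hπ _ hg0
    rw [← h1, hc, map_smul, Algebra.smul_def, Polynomial.algebraMap_apply, htA, C_0, zero_mul]
  have hP0 : P = 0 := by
    have h1 := coeff_comp_degree_mul_degree (p := P) (q := Q) (by rwa [hQdeg])
    rw [hPQ, coeff_zero, leadingCoeff, leadingCoeff, hQdeg] at h1
    exact leadingCoeff_eq_zero.1 (((hQc.pow _).mul_left_eq_zero).1 h1.symm)
  have hG0 : G.map (evalImage k π b n) = 0 :=
    (Polynomial.map_injective _ Subtype.val_injective) (hP0.trans (Polynomial.map_zero _).symm)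
  have := hT.aeval_X_sub_mem_towerIdeal (k := k) (G := G) (H := 0) (by
    rw [hG0, Polynomial.map_zero])
  rwa [map_zero, sub_zero] at this

end Existence

/-! ### Actions on the generic fibre -/

section GenericFibre

variable {O B K : Type*} [CommRing O] [CommRing B] [Algebra O B] [Field K]
  [Algebra O K]

open TensorProduct in
/-- If `B` is flat and generically generated by the transcendental element `b`, then it embeds into
the polynomial ring over the fraction field, with `b` going to the variable. -/
theorem exists_algHom_polynomial [IsDomain O] [IsFractionRing O K] [Module.Flat O B] {b : B}
    (htr : ∀ q : O[X], aeval b q = 0 → q = 0)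
    (hgen : ∀ a : B, ∃ v : O, v ≠ 0 ∧ ∃ q : O[X], v • a = aeval b q) :
    ∃ ι : B →ₐ[O] K[X], Function.Injective ι ∧ ι b = X := by
  let j : B →ₐ[O] K ⊗[O] B := Algebra.TensorProduct.includeRight
  have hj : Function.Injective j :=
    Algebra.TensorProduct.includeRight_injective (IsFractionRing.injective O K)
  have hae : ∀ q : O[X], aeval (j b) (q.map (algebraMap O K)) = j (aeval b q) := by
    intro q
    rw [aeval_map_algebraMap, aeval_algHom_apply]
  have hbij : Function.Bijective (aeval (j b) : K[X] →ₐ[K] K ⊗[O] B) := by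
    constructor
    · rw [injective_iff_map_eq_zero]
      intro P hP
      obtain ⟨v, hvm, hv⟩ := IsLocalization.integerNormalization_spec (nonZeroDivisors O) P
      have h := congrArg (aeval (j b)) hv
      rw [hae, ← algebraMap_smul K v P, map_smul, hP, smul_zero, map_eq_zero_iff j hj] at h
      rw [htr _ h, Polynomial.map_zero] at hv
      rw [← algebraMap_smul K v P] at hv
      refine (smul_eq_zero.1 hv.symm).resolve_left ?_
      rw [FaithfulSMul.algebraMap_eq_zero_iff]
      exact nonZeroDivisors.ne_zero hvm
    · intro x
      induction x with
      | zero => exact ⟨0, map_zero _⟩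
      | add x y hx hy =>
        obtain ⟨p, rfl⟩ := hx
        obtain ⟨q, rfl⟩ := hy
        exact ⟨p + q, map_add _ _ _⟩
      | tmul c a =>
        obtain ⟨v, hv, q, hq⟩ := hgen a
        have hv' : algebraMap O K v ≠ 0 := by rwa [Ne, FaithfulSMul.algebraMap_eq_zero_iff]
        refine ⟨C (c * (algebraMap O K v)⁻¹) * q.map (algebraMap O K), ?_⟩
        rw [map_mul, hae, aeval_C, ← hq, map_smul, Algebra.TensorProduct.algebraMap_apply,
          Algebra.TensorProduct.includeRight_apply, TensorProduct.smul_tmul',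
          Algebra.TensorProduct.tmul_mul_tmul, one_mul, Algebra.algebraMap_self_apply,
          Algebra.smul_def]
        congr 1
        field_simp
  let e := AlgEquiv.ofBijective (aeval (j b) : K[X] →ₐ[K] K ⊗[O] B) hbij
  refine ⟨((e.symm : K ⊗[O] B →ₐ[K] K[X]).restrictScalars O).comp j, ?_, ?_⟩
  · exact e.symm.injective.comp hj
  · change e.symm (j b) = X
    rw [AlgEquiv.symm_apply_eq]
    exact (aeval_X _).symm

namespace GaAction

/-- An action on `B` extends to the affine line over the fraction field. -/
theorem exists_extension [IsFractionRing O K] (ρ : GaAction O B) (ι : B →ₐ[O] K[X])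
    {b : B} (hb : ι b = X)
    (hgen : ∀ a : B, ∃ v : O, v ≠ 0 ∧ ∃ q : O[X], v • a = aeval b q) :
    ∃ σ : GaAction K K[X], ∀ a, σ.exp (ι a) = (ρ.exp a).map (ι : B →+* K[X]) := by
  let E : K[X] →ₐ[K] K[X][X] := aeval ((ρ.exp b).map (ι : B →+* K[X]))
  let EO : K[X] →ₐ[O] K[X][X] := E.restrictScalars O
  let M : B →ₐ[O] K[X][X] := (mapAlgHom ι).comp ρ.exp
  have hX : E X = (ρ.exp b).map (ι : B →+* K[X]) := aeval_X _
  have hE : ∀ a, E (ι a) = (ρ.exp a).map (ι : B →+* K[X]) := by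
    intro a
    obtain ⟨v, hv, q, hq⟩ := hgen a
    have h1 : v • EO (ι a) = v • M a := by
      rw [← map_smul, ← map_smul, ← map_smul, hq, ← aeval_algHom_apply, ← aeval_algHom_apply,
        ← aeval_algHom_apply, hb,
        show EO X = M b from hX]
    rw [← algebraMap_smul K v (EO (ι a)), ← algebraMap_smul K v (M a)] at h1
    refine smul_right_injective _ (?_ : algebraMap O K v ≠ 0) h1
    rwa [Ne, map_eq_zero_iff _ (IsFractionRing.injective O K)]
  have hcomp : (E : K[X] →+* K[X][X]).comp (ι : B →+* K[X]) =
      (mapRingHom (ι : B →+* K[X])).comp (ρ.exp : B →+* B[X]) := RingHom.ext hE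
  refine ⟨⟨E, fun q ↦ ?_, fun q ↦ ?_⟩, hE⟩
  · have h : ((evalRingHom 0).comp (E : K[X] →+* K[X][X])) = RingHom.id K[X] := by
      refine Polynomial.ringHom_ext (fun c ↦ ?_) ?_
      · simp [E]
      · have h0 : (ρ.exp b).coeff 0 = b := ρ.δ_zero b
        rw [RingHom.comp_apply, RingHom.coe_coe, hX, coe_evalRingHom, ← coeff_zero_eq_eval_zero,
          coeff_map, h0, RingHom.coe_coe, hb, RingHom.id_apply]
    exact RingHom.congr_fun h q
  · have h : (mapRingHom (E : K[X] →+* K[X][X])).comp (E : K[X] →+* K[X][X]) =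
        (eval₂RingHom (S := K[X][X][X]) (C.comp C) (X + C X)).comp (E : K[X] →+* K[X][X]) := by
      refine Polynomial.ringHom_ext (fun c ↦ ?_) ?_
      · simp [E]
      · rw [RingHom.comp_apply, RingHom.comp_apply, RingHom.coe_coe, hX, coe_mapRingHom,
          Polynomial.map_map, hcomp, ← Polynomial.map_map, ρ.exp_add, ← coe_mapRingHom, hom_eval₂,
          coe_eval₂RingHom, eval₂_map]
        congr 1
        · ext1 x
          simp
        · simp
    exact RingHom.congr_fun h q

/-- An action on the affine line over the fraction field restricts to any stable subalgebra. -/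
theorem exists_restriction (σ : GaAction K K[X]) (ι : B →ₐ[O] K[X]) (hι : Function.Injective ι)
    (hσ : σ.Stabilizes (ι.range : Set K[X])) :
    ∃ ρ : GaAction O B, ∀ a, σ.exp (ι a) = (ρ.exp a).map (ι : B →+* K[X]) := by
  let j : B[X] →ₐ[O] K[X][X] := mapAlgHom ι
  have hj : Function.Injective j := Polynomial.map_injective _ hι
  have hmem : ∀ a, ((σ.exp.restrictScalars O).comp ι) a ∈ j.range := by
    intro a
    exact (Polynomial.mem_map_range (ι : B →+* K[X])).2 fun i ↦ hσ (ι a) ⟨a, rfl⟩ i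
  let E : B →ₐ[O] B[X] := ((AlgEquiv.ofInjective j hj).symm : j.range →ₐ[O] B[X]).comp
    (((σ.exp.restrictScalars O).comp ι).codRestrict j.range hmem)
  have hE : ∀ a, σ.exp (ι a) = (E a).map (ι : B →+* K[X]) := by
    intro a
    have h : AlgEquiv.ofInjective j hj (E a) = ⟨σ.exp (ι a), hmem a⟩ :=
      (AlgEquiv.ofInjective j hj).apply_symm_apply _
    exact (congrArg Subtype.val h).symm
  refine ⟨⟨E, fun a ↦ hι ?_, fun a ↦ ?_⟩, hE⟩
  · have h := σ.exp_zero (ι a)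
    rw [hE, ← coeff_zero_eq_eval_zero, coeff_map] at h
    rw [← coeff_zero_eq_eval_zero]
    exact h
  · have hcomp : (mapRingHom (ι : B →+* K[X])).comp (E : B →+* B[X]) =
        (σ.exp : K[X] →+* K[X][X]).comp (ι : B →+* K[X]) := RingHom.ext fun x ↦ (hE x).symm
    refine Polynomial.map_injective (mapRingHom (ι : B →+* K[X]))
      (Polynomial.map_injective _ hι) ?_
    rw [Polynomial.map_map, hcomp, ← Polynomial.map_map, ← hE, σ.exp_add, hE,
      ← coe_mapRingHom (mapRingHom _), hom_eval₂, eval₂_map]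
    congr 1
    · ext1 x
      simp
    · simp

/-- Actions on `B` correspond to the additive actions on the affine line over the fraction field
which let the image of `B` stable. -/
theorem exists_equiv_stabilizes [IsFractionRing O K] (p : ℕ) [ExpChar K p] (ι : B →ₐ[O] K[X])
    (hι : Function.Injective ι) {b : B} (hb : ι b = X)
    (hgen : ∀ a : B, ∃ v : O, v ≠ 0 ∧ ∃ q : O[X], v • a = aeval b q) :
    ∃ Φ : GaAction O B ≃ {σ : GaAction K K[X] // σ.IsAdditive p ∧
      σ.Stabilizes (ι.range : Set K[X])}, ∀ ρ i a, ι (ρ.δ i a) = (Φ ρ).1.δ i (ι a) := by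
  choose F hF using fun ρ : GaAction O B ↦ ρ.exists_extension (K := K) ι hb hgen
  have hFδ : ∀ ρ i a, ι (ρ.δ i a) = (F ρ).δ i (ι a) := by
    intro ρ i a
    rw [δ, δ, hF, coeff_map, RingHom.coe_coe]
  let G : GaAction O B → {σ : GaAction K K[X] // σ.IsAdditive p ∧
      σ.Stabilizes (ι.range : Set K[X])} := fun ρ ↦ ⟨F ρ, (F ρ).isAdditive p, by
    rintro _ ⟨a, rfl⟩ i
    exact ⟨ρ.δ i a, hFδ ρ i a⟩⟩
  have hG : Function.Bijective G := by
    constructor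
    · intro ρ ρ' h
      have h : F ρ = F ρ' := congrArg Subtype.val h
      ext1 a
      refine Polynomial.map_injective (ι : B →+* K[X]) hι ?_
      rw [← hF, ← hF, h]
    · rintro ⟨σ, hσ, hst⟩
      obtain ⟨ρ, hρ⟩ := σ.exists_restriction ι hι hst
      refine ⟨ρ, Subtype.ext (GaAction.ext fun q ↦ ?_)⟩
      have h : (F ρ).exp = σ.exp := by
        apply Polynomial.algHom_ext
        rw [← hb, hF, hρ]
      exact DFunLike.congr_fun h q
  exact ⟨Equiv.ofBijective G hG, hFδ⟩

end GaAction

end GenericFibre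

/-! ### The centres of the dilatations -/

namespace MvPolynomial

variable {O : Type*} [CommRing O]

/-- Restriction to the first `n` variables, the other ones being sent to zero. -/
noncomputable def killAbove (n : ℕ) : MvPolynomial ℕ O →ₐ[O] MvPolynomial (Fin n) O :=
  aeval fun j ↦ if h : j < n then X ⟨j, h⟩ else 0

theorem killAbove_X {n j : ℕ} (h : j < n) : killAbove n (X j : MvPolynomial ℕ O) = X ⟨j, h⟩ := by
  rw [killAbove, aeval_X, dif_pos h]

theorem killAbove_rename {n : ℕ} (p : MvPolynomial (Fin n) O) :
    killAbove n (rename (Fin.val) p) = p := by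
  rw [killAbove, aeval_rename]
  conv_rhs => rw [← aeval_X_left_apply p]
  congr 2
  ext1 i
  simp

theorem rename_killAbove {n : ℕ} {p : MvPolynomial ℕ O} (hp : p ∈ supported O (Set.Iio n)) :
    rename Fin.val (killAbove n p) = p := by
  have hle : supported O (Set.Iio n) ≤ AlgHom.equalizer
      ((rename (Fin.val : Fin n → ℕ)).comp (killAbove n)) (AlgHom.id O (MvPolynomial ℕ O)) := by
    rw [supported_eq_adjoin_X, Algebra.adjoin_le_iff]
    rintro _ ⟨j, hj, rfl⟩
    rw [SetLike.mem_coe, AlgHom.mem_equalizer, AlgHom.comp_apply, killAbove_X hj, rename_X]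
    rfl
  exact hle hp

theorem rename_val_mem_supported {n : ℕ} (p : MvPolynomial (Fin n) O) :
    rename Fin.val p ∈ supported O (Set.Iio n) := by
  induction p using MvPolynomial.induction_on with
  | C a =>
    rw [rename_C]
    exact Subalgebra.algebraMap_mem _ a
  | add p q hp hq =>
    rw [map_add]
    exact Subalgebra.add_mem _ hp hq
  | mul_X p i hp =>
    rw [map_mul, rename_X]
    exact Subalgebra.mul_mem _ hp (Algebra.subset_adjoin (Set.mem_image_of_mem X i.2))

theorem killAbove_mem_supported {n : ℕ} {i : Fin n} {p : MvPolynomial ℕ O}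
    (hp : p ∈ supported O (Set.Iic (i : ℕ))) : killAbove n p ∈ supported O {j : Fin n | j ≤ i} := by
  have hle : supported O (Set.Iic (i : ℕ)) ≤ (supported O {j : Fin n | j ≤ i}).comap
      (killAbove n) := by
    rw [supported_eq_adjoin_X, Algebra.adjoin_le_iff]
    rintro _ ⟨j, hj, rfl⟩
    have hjn : j < n := (Set.mem_Iic.1 hj).trans_lt i.2
    rw [SetLike.mem_coe, Subalgebra.mem_comap, killAbove_X hjn]
    exact Algebra.subset_adjoin (Set.mem_image_of_mem X (Set.mem_Iic.1 hj : (⟨j, hjn⟩ : Fin n) ≤ i))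
  exact hle hp

theorem rename_castSucc_killAbove {n : ℕ} {p : MvPolynomial ℕ O}
    (hp : p ∈ supported O (Set.Iio n)) :
    rename Fin.castSucc (killAbove n p) = killAbove (n + 1) p := by
  rw [← killAbove_rename (rename Fin.castSucc (killAbove n p)), rename_rename]
  conv_rhs => rw [← rename_killAbove hp]
  rfl

theorem killAbove_mem_centerIdeal {t : O} {f : ℕ → MvPolynomial ℕ O} {n m : ℕ} (hm : m ≤ n)
    {p : MvPolynomial ℕ O} (hp : p ∈ towerIdeal t f m) :
    killAbove n p ∈ centerIdeal t (fun i : Fin n ↦ killAbove n (f i)) m := by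
  have hle : towerIdeal t f m ≤ (centerIdeal t (fun i : Fin n ↦ killAbove n (f i)) m).comap
      (killAbove n) := by
    rw [towerIdeal, Ideal.span_le]
    rintro _ (rfl | ⟨i, hi, rfl⟩)
    · exact Ideal.subset_span (Or.inl (by rw [killAbove, aeval_C]; rfl))
    · exact Ideal.subset_span (Or.inr ⟨⟨i, (Set.mem_Iio.1 hi).trans_le hm⟩, hi, rfl⟩)
  exact hle hp

end MvPolynomial

open MvPolynomial (killAbove)

namespace IsDilatationTower

variable {O B A : Type*} [CommRing O] [CommRing B] [CommRing A] [Algebra O B] [Algebra O A]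
  {t : O} {π : B →ₐ[O] A} {f : ℕ → MvPolynomial ℕ O} {b : ℕ → B} {n : ℕ}

theorem mem_supported_Iio (hT : IsDilatationTower t π f b n) {i : ℕ} (hi : i < n) :
    f i ∈ supported O (Set.Iio n) :=
  MvPolynomial.supported_mono (fun _ hj ↦ Set.mem_Iio.2 ((Set.mem_Iic.1 hj).trans_lt hi))
    (hT.mem_supported i hi)

theorem aeval_killAbove (hT : IsDilatationTower t π f b n) {i : ℕ} (hi : i < n) :
    MvPolynomial.aeval (fun j : Fin n ↦ b j) (killAbove n (f i)) = t • b (i + 1) := by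
  rw [hT.smul_eq i hi]
  conv_rhs => rw [← MvPolynomial.rename_killAbove (hT.mem_supported_Iio hi),
    MvPolynomial.aeval_rename]
  rfl

/-- The centre of the last dilatation is the kernel of the evaluation in the special fibre. -/
theorem mem_centerIdeal_iff (hT : IsDilatationTower t π f b n) (htA : algebraMap O A t = 0)
    {p : MvPolynomial (Fin n) O} :
    p ∈ centerIdeal t (fun i : Fin n ↦ killAbove n (f i)) n ↔
      π (MvPolynomial.aeval (fun j : Fin n ↦ b j) p) = 0 := by
  constructor
  · intro hp
    have hle : centerIdeal t (fun i : Fin n ↦ killAbove n (f i)) n ≤ RingHom.ker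
        (π.comp (MvPolynomial.aeval fun j : Fin n ↦ b j)) := by
      rw [centerIdeal, Ideal.span_le]
      rintro _ (rfl | ⟨i, hi, rfl⟩)
      · rw [SetLike.mem_coe, RingHom.mem_ker, AlgHom.comp_apply, MvPolynomial.aeval_C,
          AlgHom.commutes, htA]
      · rw [SetLike.mem_coe, RingHom.mem_ker, AlgHom.comp_apply, hT.aeval_killAbove i.2, map_smul,
          Algebra.smul_def, htA, zero_mul]
    exact hle hp
  · intro hp
    rw [← MvPolynomial.killAbove_rename p]
    refine MvPolynomial.killAbove_mem_centerIdeal le_rfl (hT.mem_towerIdeal n le_rfl _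
      (MvPolynomial.rename_val_mem_supported p) ?_)
    rw [MvPolynomial.aeval_rename]
    exact hp

theorem isRadical_centerIdeal [IsReduced A] (hT : IsDilatationTower t π f b n)
    (htA : algebraMap O A t = 0) :
    (centerIdeal t (fun i : Fin n ↦ killAbove n (f i)) n).IsRadical := by
  rintro p ⟨N, hN⟩
  rw [hT.mem_centerIdeal_iff htA, map_pow, map_pow] at hN
  exact (hT.mem_centerIdeal_iff htA).2 (eq_zero_of_pow_eq_zero hN)

theorem isUnit_pderiv (hT : IsDilatationTower t π f b n) (i : Fin n) :
    IsUnit (Ideal.Quotient.mk (centerIdeal t (fun i : Fin n ↦ killAbove n (f i)) ((i : ℕ) + 1))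
      (pderiv i (killAbove n (f i)))) := by
  obtain ⟨w, hw, h⟩ := hT.exists_inverse i i.2
  have hmem : pderiv (i : ℕ) (f i) * w - 1 ∈ towerIdeal t f (i + 1) := by
    refine hT.mem_towerIdeal (i + 1) i.2 _ ?_ (by
      rw [map_sub, map_one, map_sub, h, map_one, sub_self])
    rw [show Set.Iio ((i : ℕ) + 1) = Set.Iic (i : ℕ) by ext; simp]
    exact Subalgebra.sub_mem _ (Subalgebra.mul_mem _
      (MvPolynomial.pderiv_mem_supported_Iic (hT.mem_supported i i.2)) hw) (Subalgebra.one_mem _)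
  have hpd : killAbove n (pderiv (i : ℕ) (f i)) = pderiv i (killAbove n (f i)) := by
    conv_lhs => rw [← MvPolynomial.rename_killAbove (hT.mem_supported_Iio i.2),
      MvPolynomial.pderiv_rename Fin.val_injective, MvPolynomial.killAbove_rename]
  refine IsUnit.of_mul_eq_one (Ideal.Quotient.mk _ (killAbove n w)) ?_
  rw [← map_mul, ← map_one (Ideal.Quotient.mk _), Ideal.Quotient.eq, ← hpd, ← map_mul,
    ← map_one (killAbove n), ← map_sub]
  exact MvPolynomial.killAbove_mem_centerIdeal i.2 hmem

/-- The centre is the spectrum of the finite `k`-algebra generated by the `π (b j)`. -/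
theorem ringKrullDim_quotient_centerIdeal {k : Type*} [Field k] [Algebra k A] [Algebra O k]
    [IsScalarTower O k A] [Nontrivial A] (hk : Function.Surjective (algebraMap O k))
    (hT : IsDilatationTower t π f b n) (htA : algebraMap O A t = 0)
    (halg : ∀ j < n, IsAlgebraic k (π (b j))) :
    ringKrullDim (MvPolynomial (Fin n) O ⧸
      centerIdeal t (fun i : Fin n ↦ killAbove n (f i)) n) = 0 := by
  have := finite_imageSubalgebra π b n halg
  have : IsArtinianRing (imageSubalgebra k π b n) := IsArtinianRing.of_finite k _
  let e : MvPolynomial (Fin n) O →+* imageSubalgebra k π b n :=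
    RingHom.codRestrict ((π.comp (MvPolynomial.aeval fun j : Fin n ↦ b j) : _ →ₐ[O] A) :
      MvPolynomial (Fin n) O →+* A) (imageSubalgebra k π b n) fun p ↦ by
        have := map_aeval_mem_imageSubalgebra (k := k) π b
          (MvPolynomial.rename_val_mem_supported p)
        rwa [MvPolynomial.aeval_rename] at this
  have he : ∀ p, (e p : A) = π (MvPolynomial.aeval (fun j : Fin n ↦ b j) p) := fun p ↦ rfl
  have hsurj : Function.Surjective e := by
    intro x
    obtain ⟨g, hg⟩ := evalImage_surjective hk π b n x
    refine ⟨killAbove n g, Subtype.ext ?_⟩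
    rw [← hg, he, coe_evalImage]
    conv_rhs => rw [← MvPolynomial.rename_killAbove g.2, MvPolynomial.aeval_rename]
    rfl
  have hker : centerIdeal t (fun i : Fin n ↦ killAbove n (f i)) n = RingHom.ker e := by
    ext p
    rw [hT.mem_centerIdeal_iff htA, RingHom.mem_ker, ← he, ZeroMemClass.coe_eq_zero]
  rw [hker, ringKrullDim_eq_of_ringEquiv (RingHom.quotientKerEquivOfSurjective hsurj)]
  exact le_antisymm (Ring.krullDimLE_iff.1 inferInstance) ringKrullDim_nonneg_of_nontrivial

end IsDilatationTower

/-! ### The presentation -/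

namespace IsDilatationTower

variable {O B A : Type*} [CommRing O] [CommRing B] [CommRing A] [Algebra O B] [Algebra O A]
  {t : O} {π : B →ₐ[O] A} {f : ℕ → MvPolynomial ℕ O} {b : ℕ → B} {n : ℕ}

theorem generator_mem_presentationIdeal (hT : IsDilatationTower t π f b n) {i : ℕ} (hi : i < n) :
    MvPolynomial.C t * MvPolynomial.X ⟨i + 1, Nat.succ_lt_succ hi⟩ - killAbove (n + 1) (f i) ∈
      presentationIdeal t (fun i : Fin n ↦ killAbove n (f i)) := by
  rw [← MvPolynomial.rename_castSucc_killAbove (hT.mem_supported_Iio hi)]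
  exact Ideal.subset_span ⟨⟨i, hi⟩, rfl⟩

theorem aeval_eq_zero_of_mem_presentationIdeal (hT : IsDilatationTower t π f b n)
    {p : MvPolynomial (Fin (n + 1)) O}
    (hp : p ∈ presentationIdeal t (fun i : Fin n ↦ killAbove n (f i))) :
    MvPolynomial.aeval (fun j : Fin (n + 1) ↦ b j) p = 0 := by
  have hle : presentationIdeal t (fun i : Fin n ↦ killAbove n (f i)) ≤
      RingHom.ker (MvPolynomial.aeval fun j : Fin (n + 1) ↦ b j) := by
    rw [presentationIdeal, Ideal.span_le]
    rintro _ ⟨i, rfl⟩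
    rw [SetLike.mem_coe, RingHom.mem_ker, map_sub, map_mul, MvPolynomial.aeval_C,
      MvPolynomial.aeval_X, MvPolynomial.aeval_rename, ← Algebra.smul_def]
    exact sub_eq_zero.2 (hT.aeval_killAbove i.2).symm
  exact hle hp

/-- Modulo the defining relations, a polynomial vanishing in the special fibre is divisible
by `t`, since `f i` is congruent to `t * X (i + 1)`. -/
theorem exists_sub_mem_presentationIdeal (hT : IsDilatationTower t π f b n)
    (hmem : ∀ g ∈ supported O (Set.Iic n), π (MvPolynomial.aeval b g) = 0 → g ∈ towerIdeal t f n)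
    {p : MvPolynomial (Fin (n + 1)) O}
    (hp : π (MvPolynomial.aeval (fun j : Fin (n + 1) ↦ b j) p) = 0) :
    ∃ q, p - MvPolynomial.C t * q ∈
      presentationIdeal t (fun i : Fin n ↦ killAbove n (f i)) := by
  set I := presentationIdeal t (fun i : Fin n ↦ killAbove n (f i)) with hI
  have h1 : MvPolynomial.rename Fin.val p ∈ towerIdeal t f n := by
    refine hmem _ ?_ (by rw [MvPolynomial.aeval_rename]; exact hp)
    rw [show Set.Iic n = Set.Iio (n + 1) by ext; simp]
    exact MvPolynomial.rename_val_mem_supported p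
  have hle : towerIdeal t f n ≤ (I ⊔ Ideal.span {MvPolynomial.C t}).comap (killAbove (n + 1)) := by
    rw [towerIdeal, Ideal.span_le]
    rintro _ (rfl | ⟨i, hi, rfl⟩)
    · rw [SetLike.mem_coe, Ideal.mem_comap, killAbove, MvPolynomial.aeval_C]
      exact Ideal.mem_sup_right (Ideal.mem_span_singleton_self _)
    · rw [SetLike.mem_coe, Ideal.mem_comap]
      have h2 := hT.generator_mem_presentationIdeal hi
      rw [← sub_sub_cancel (MvPolynomial.C t * MvPolynomial.X ⟨i + 1, Nat.succ_lt_succ hi⟩)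
        (killAbove (n + 1) (f i))]
      exact Ideal.sub_mem _ (Ideal.mem_sup_right (Ideal.mul_mem_right _ _
        (Ideal.mem_span_singleton_self _))) (Ideal.mem_sup_left h2)
  have h2 := hle h1
  rw [Ideal.mem_comap, MvPolynomial.killAbove_rename] at h2
  obtain ⟨x, hx, y, hy, hxy⟩ := Submodule.mem_sup.1 h2
  obtain ⟨q, rfl⟩ := Ideal.mem_span_singleton.1 hy
  exact ⟨q, by rwa [← hxy, add_sub_cancel_right]⟩

/-- After multiplication by a power of `t`, every polynomial is congruent to a polynomial in the
first variable. -/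
theorem exists_pow_mul_sub_mem (hT : IsDilatationTower t π f b n)
    (p : MvPolynomial (Fin (n + 1)) O) : ∃ (N : ℕ) (G : O[X]),
      MvPolynomial.C t ^ N * p - aeval (MvPolynomial.X 0 : MvPolynomial (Fin (n + 1)) O) G ∈
        presentationIdeal t (fun i : Fin n ↦ killAbove n (f i)) := by
  set I := presentationIdeal t (fun i : Fin n ↦ killAbove n (f i)) with hI
  -- the polynomials with this property form a subalgebra
  let T : Subalgebra O (MvPolynomial (Fin (n + 1)) O) :=
    { carrier := {p | ∃ (N : ℕ) (G : O[X]), MvPolynomial.C t ^ N * p -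
        aeval (MvPolynomial.X 0 : MvPolynomial (Fin (n + 1)) O) G ∈ I}
      mul_mem' := by
        rintro p q ⟨N, G, hG⟩ ⟨N', G', hG'⟩
        refine ⟨N + N', G * G', ?_⟩
        convert I.add_mem (I.mul_mem_left (MvPolynomial.C t ^ N * p) hG')
          (I.mul_mem_left (aeval (MvPolynomial.X 0 : MvPolynomial (Fin (n + 1)) O) G') hG) using 1
        rw [map_mul]
        ring
      add_mem' := by
        rintro p q ⟨N, G, hG⟩ ⟨N', G', hG'⟩
        refine ⟨N + N', C t ^ N' * G + C t ^ N * G', ?_⟩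
        convert I.add_mem (I.mul_mem_left (MvPolynomial.C t ^ N') hG)
          (I.mul_mem_left (MvPolynomial.C t ^ N) hG') using 1
        rw [map_add, map_mul, map_mul, map_pow, map_pow, aeval_C, MvPolynomial.algebraMap_eq]
        ring
      algebraMap_mem' := fun r ↦ ⟨0, C r, by
        rw [aeval_C, pow_zero, one_mul, sub_self]
        exact I.zero_mem⟩ }
  have hX : ∀ i (hi : i < n + 1), MvPolynomial.X ⟨i, hi⟩ ∈ T := by
    intro i
    induction i using Nat.strong_induction_on with
    | _ i ih =>
    intro hi
    rcases i with _ | i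
    · exact ⟨0, X, by
        rw [aeval_X, pow_zero, one_mul]
        convert I.zero_mem
        exact sub_self _⟩
    · have hin : i < n := Nat.lt_of_succ_lt_succ hi
      have hle : supported O (Set.Iic i) ≤ T.comap (killAbove (n + 1)) := by
        rw [MvPolynomial.supported_eq_adjoin_X, Algebra.adjoin_le_iff]
        rintro _ ⟨j, hj, rfl⟩
        have hj := Set.mem_Iic.1 hj
        rw [SetLike.mem_coe, Subalgebra.mem_comap, MvPolynomial.killAbove_X (by omega)]
        exact ih j (by omega) _
      obtain ⟨N, G, hG⟩ := hle (hT.mem_supported i hin)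
      change MvPolynomial.C t ^ N * killAbove (n + 1) (f i) - aeval _ G ∈ I at hG
      refine ⟨N + 1, G, ?_⟩
      convert I.add_mem (I.mul_mem_left (MvPolynomial.C t ^ N)
        (hT.generator_mem_presentationIdeal hin)) hG using 1
      ring
  have hp : p ∈ Algebra.adjoin O (Set.range (MvPolynomial.X : Fin (n + 1) → _)) := by
    rw [MvPolynomial.adjoin_range_X]
    trivial
  refine (Algebra.adjoin_le ?_ : _ ≤ T) hp
  rintro _ ⟨i, rfl⟩
  exact hX i.1 i.2

/-- The relations between `b 0, …, b n` are generated by the defining relations of the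
dilatations. The quotient `Q` of the former by the latter satisfies `Q = t Q` and is `t`-power
torsion, so it vanishes as it is finitely generated. -/
theorem mem_presentationIdeal_iff [IsDomain O] [IsNoetherianRing O] [IsDomain B] [FaithfulSMul O B]
    (ht : t ≠ 0) (hT : IsDilatationTower t π f b n)
    (hmem : ∀ g ∈ supported O (Set.Iic n), π (MvPolynomial.aeval b g) = 0 → g ∈ towerIdeal t f n)
    (htr : ∀ q : O[X], aeval (b 0) q = 0 → q = 0) {p : MvPolynomial (Fin (n + 1)) O} :
    p ∈ presentationIdeal t (fun i : Fin n ↦ killAbove n (f i)) ↔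
      MvPolynomial.aeval (fun j : Fin (n + 1) ↦ b j) p = 0 := by
  refine ⟨hT.aeval_eq_zero_of_mem_presentationIdeal, ?_⟩
  set I := presentationIdeal t (fun i : Fin n ↦ killAbove n (f i)) with hI
  have htB : algebraMap O B t ≠ 0 := by rwa [Ne, FaithfulSMul.algebraMap_eq_zero_iff]
  -- every relation is congruent to `t ^ N` times a relation, for all `N`
  have hdiv : ∀ (N : ℕ) (p : MvPolynomial (Fin (n + 1)) O),
      MvPolynomial.aeval (fun j : Fin (n + 1) ↦ b j) p = 0 →
      ∃ q, MvPolynomial.aeval (fun j : Fin (n + 1) ↦ b j) q = 0 ∧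
        p - MvPolynomial.C t ^ N * q ∈ I := by
    intro N
    induction N with
    | zero => exact fun p hp ↦ ⟨p, hp, by simp⟩
    | succ N ih =>
      intro p hp
      obtain ⟨q, hq, hqI⟩ := ih p hp
      obtain ⟨r, hr⟩ := hT.exists_sub_mem_presentationIdeal hmem (p := q) (by rw [hq, map_zero])
      refine ⟨r, ?_, ?_⟩
      · have h := hT.aeval_eq_zero_of_mem_presentationIdeal hr
        rw [map_sub, hq, zero_sub, neg_eq_zero, map_mul, MvPolynomial.aeval_C] at h
        exact (mul_eq_zero.1 h).resolve_left htB
      · convert I.add_mem hqI (I.mul_mem_left (MvPolynomial.C t ^ N) hr) using 1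
        ring
  have htors : ∀ p : MvPolynomial (Fin (n + 1)) O,
      MvPolynomial.aeval (fun j : Fin (n + 1) ↦ b j) p = 0 → ∃ N, MvPolynomial.C t ^ N * p ∈ I := by
    intro p hp
    obtain ⟨N, G, hG⟩ := hT.exists_pow_mul_sub_mem p
    have h := hT.aeval_eq_zero_of_mem_presentationIdeal hG
    rw [map_sub, map_mul, hp, mul_zero, zero_sub, neg_eq_zero, ← aeval_algHom_apply,
      MvPolynomial.aeval_X] at h
    rw [htr G h, map_zero, sub_zero] at hG
    exact ⟨N, hG⟩
  -- the `t`-power torsion modulo `I` has bounded exponent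
  let J : ℕ →o Submodule (MvPolynomial (Fin (n + 1)) O) (MvPolynomial (Fin (n + 1)) O) :=
    { toFun := fun N ↦ Submodule.comap (LinearMap.mulLeft _ (MvPolynomial.C t ^ N)) I
      monotone' := by
        intro N N' h p hp
        obtain ⟨e, rfl⟩ := Nat.exists_eq_add_of_le' h
        rw [Submodule.mem_comap, LinearMap.mulLeft_apply] at hp ⊢
        rw [pow_add, mul_assoc]
        exact I.mul_mem_left _ hp }
  obtain ⟨N, hN⟩ := monotone_stabilizes_iff_noetherian.2
    (inferInstance : IsNoetherian (MvPolynomial (Fin (n + 1)) O) _) J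
  intro hp
  obtain ⟨q, hq, hqI⟩ := hdiv N p hp
  obtain ⟨M, hM⟩ := htors q hq
  have h1 : q ∈ J N := by
    rw [hN (max N M) (le_max_left _ _)]
    exact J.monotone (le_max_right N M) hM
  have h2 : MvPolynomial.C t ^ N * q ∈ I := h1
  convert I.add_mem hqI h2 using 1
  ring

/-- The elements of the tower generate `B`: every element becomes a polynomial in `b 0` after
multiplication by a power of `t`, and if `t * a` is a polynomial in the `b j`, so is `a`. -/
theorem aeval_surjective [IsDomain O] [IsDiscreteValuationRing O] [IsDomain B] [FaithfulSMul O B]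
    (ht : Irreducible t) (htA : algebraMap O A t = 0) (hT : IsDilatationTower t π f b n)
    (hmem : ∀ g ∈ supported O (Set.Iic n), π (MvPolynomial.aeval b g) = 0 → g ∈ towerIdeal t f n)
    (hgen : ∀ a : B, ∃ v : O, v ≠ 0 ∧ ∃ q : O[X], v • a = aeval (b 0) q) :
    Function.Surjective (MvPolynomial.aeval (R := O) fun j : Fin (n + 1) ↦ b j) := by
  set ev := MvPolynomial.aeval (R := O) fun j : Fin (n + 1) ↦ b j with hev
  have htB : algebraMap O B t ≠ 0 := by
    rw [Ne, FaithfulSMul.algebraMap_eq_zero_iff]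
    exact ht.ne_zero
  have hdiv : ∀ (N : ℕ) (a : B), t ^ N • a ∈ ev.range → a ∈ ev.range := by
    intro N
    induction N with
    | zero => exact fun a ha ↦ by simpa using ha
    | succ N ih =>
      intro a ha
      rw [pow_succ, mul_smul] at ha
      obtain ⟨g, hg⟩ := ih _ ha
      change ev g = _ at hg
      obtain ⟨q, hq⟩ := hT.exists_sub_mem_presentationIdeal hmem (p := g) (by
        rw [← hev, hg, map_smul, Algebra.smul_def, htA, zero_mul])
      have h := hT.aeval_eq_zero_of_mem_presentationIdeal hq
      rw [← hev, map_sub, hg, map_mul, hev, MvPolynomial.aeval_C, ← hev, Algebra.smul_def,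
        ← mul_sub] at h
      exact ⟨q, (sub_eq_zero.1 ((mul_eq_zero.1 h).resolve_left htB)).symm⟩
  intro a
  obtain ⟨v, hv, q, hq⟩ := hgen a
  obtain ⟨N, u, rfl⟩ := IsDiscreteValuationRing.eq_unit_mul_pow_irreducible hv ht
  refine hdiv N a ⟨MvPolynomial.C (↑u⁻¹ : O) *
    aeval (MvPolynomial.X 0 : MvPolynomial (Fin (n + 1)) O) q, ?_⟩
  change ev _ = _
  rw [map_mul, hev, MvPolynomial.aeval_C, ← aeval_algHom_apply, MvPolynomial.aeval_X,
    ← Algebra.smul_def]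
  change (↑u⁻¹ : O) • aeval (b 0) q = _
  rw [← hq, ← mul_smul, Units.inv_mul_cancel_left]

end IsDilatationTower

/-! ### Fibres of the curve and the structure theorem -/

section Fibres

open TensorProduct

/-- The base change of `B` along a surjection `O → k` is the quotient by the extension of the
kernel. -/
theorem mem_map_ker_of_one_tmul_eq_zero {O k B : Type*} [CommRing O] [CommRing k] [CommRing B]
    [Algebra O k] [Algebra O B] (hk : Function.Surjective (algebraMap O k)) {x : B}
    (hx : (1 : k) ⊗ₜ[O] x = 0) : x ∈ (RingHom.ker (algebraMap O k)).map (algebraMap O B) := by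
  have h := Algebra.TensorProduct.rTensor_ker (R := O) (S := O) (C := B) (Algebra.ofId O k) hk
  have h1 : (1 : O) ⊗ₜ[O] x ∈ RingHom.ker
      (Algebra.TensorProduct.map (Algebra.ofId O k) (AlgHom.id O B)) := by
    rw [RingHom.mem_ker, Algebra.TensorProduct.map_tmul, map_one, AlgHom.id_apply, hx]
  have hle : (RingHom.ker (Algebra.ofId O k)).map
      (Algebra.TensorProduct.includeLeft : O →ₐ[O] O ⊗[O] B) ≤
      ((RingHom.ker (algebraMap O k)).map (algebraMap O B)).comap
        (Algebra.TensorProduct.lid O B) := by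
    rw [Ideal.map_le_iff_le_comap]
    intro r hr
    rw [Ideal.mem_comap, Ideal.mem_comap, Algebra.TensorProduct.includeLeft_apply,
      Algebra.TensorProduct.lid_tmul, ← Algebra.algebraMap_eq_smul_one]
    exact Ideal.mem_map_of_mem _ hr
  have h2 := hle (h ▸ h1)
  rwa [Ideal.mem_comap, Algebra.TensorProduct.lid_tmul, one_smul] at h2

/-- If the fibre of `B` over `t = 0` is reduced, so is its base change to the residue field. -/
theorem isReduced_tensorProduct {O k B : Type*} [CommRing O] [CommRing k] [CommRing B]
    [Algebra O k] [Algebra O B] (hk : Function.Surjective (algebraMap O k)) {t : O}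
    (hker : RingHom.ker (algebraMap O k) = Ideal.span {t})
    [IsReduced (B ⧸ Ideal.span {algebraMap O B t})] : IsReduced (k ⊗[O] B) := by
  have hsurj : Function.Surjective (Algebra.TensorProduct.includeRight : B →ₐ[O] k ⊗[O] B) := by
    intro x
    induction x with
    | zero => exact ⟨0, map_zero _⟩
    | add x y hx hy =>
      obtain ⟨a, rfl⟩ := hx
      obtain ⟨b, rfl⟩ := hy
      exact ⟨a + b, map_add _ _ _⟩
    | tmul c a =>
      obtain ⟨r, rfl⟩ := hk c
      refine ⟨r • a, ?_⟩
      rw [Algebra.TensorProduct.includeRight_apply, TensorProduct.tmul_smul,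
        TensorProduct.smul_tmul', Algebra.smul_def, mul_one]
  refine ⟨fun y ⟨N, hN⟩ ↦ ?_⟩
  obtain ⟨x, rfl⟩ := hsurj y
  have h := mem_map_ker_of_one_tmul_eq_zero hk
    (show (1 : k) ⊗ₜ[O] (x ^ N) = 0 from (map_pow _ x N).trans hN)
  rw [hker, Ideal.map_span, Set.image_singleton, ← Ideal.Quotient.eq_zero_iff_mem, map_pow] at h
  have h1 := Ideal.Quotient.eq_zero_iff_mem.1 (eq_zero_of_pow_eq_zero h)
  obtain ⟨c, rfl⟩ := Ideal.mem_span_singleton.1 h1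
  have ht : algebraMap O k t = 0 := by
    rw [← RingHom.mem_ker, hker]
    exact Ideal.mem_span_singleton_self t
  rw [map_mul, AlgHom.commutes, IsScalarTower.algebraMap_apply O k, ht, map_zero, zero_mul]

namespace GaAction

variable {R B : Type*} [CommRing R] [CommRing B] [Algebra R B] {ρ : GaAction R B}

/-- An element whose comorphism becomes constant over `S` is invariant over `S`. -/
theorem IsInvariant.baseChange {b : B} (S : Type*) [CommRing S] [Algebra R S]
    (h : (ρ.exp b).map ((Algebra.TensorProduct.includeRight : B →ₐ[R] S ⊗[R] B) :
      B →+* S ⊗[R] B) = C (1 ⊗ₜ b)) : (ρ.baseChange S).IsInvariant (1 ⊗ₜ b) := by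
  change ρ.baseChangeExp S (1 ⊗ₜ b) = _
  rw [baseChangeExp_tmul, h, ← Algebra.TensorProduct.one_def, C_1, one_mul]

theorem IsFree.baseChange (h : ρ.IsFree) (S : Type*) [CommRing S] [Algebra R S] :
    (ρ.baseChange S).IsFree := by
  have hle : Ideal.span {y : B | ∃ i : ℕ, 0 < i ∧ ∃ b : B, y = ρ.δ i b} ≤
      (Ideal.span {y | ∃ i : ℕ, 0 < i ∧ ∃ b, y = (ρ.baseChange S).δ i b}).comap
        (Algebra.TensorProduct.includeRight : B →ₐ[R] S ⊗[R] B) := by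
    rw [Ideal.span_le]
    rintro _ ⟨i, hi, b, rfl⟩
    refine Ideal.subset_span ⟨i, hi, 1 ⊗ₜ b, ?_⟩
    change _ = (ρ.baseChangeExp S (1 ⊗ₜ b)).coeff i
    rw [baseChangeExp_tmul, ← Algebra.TensorProduct.one_def, C_1, one_mul, coeff_map]
    rfl
  rw [IsFree, Ideal.eq_top_iff_one]
  have h1 := hle (h ▸ Submodule.mem_top : (1 : B) ∈ _)
  rwa [Ideal.mem_comap, map_one] at h1

theorem IsFree.exists_not_isInvariant [Nontrivial B] (h : ρ.IsFree) : ∃ a, ¬ ρ.IsInvariant a := by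
  by_contra! hinv
  refine (bot_ne_top (α := Ideal B)) ?_
  rw [← h, eq_comm, Ideal.span_eq_bot]
  rintro _ ⟨i, hi, b, rfl⟩
  exact (hinv b).δ_eq_zero hi

end GaAction

/-- The invariants of a free action on an affine curve are fractions of elements of the base, as
they are algebraic on the generic fibre. -/
theorem IsAffineCurve.exists_smul_eq_algebraMap {O B : Type*} [CommRing O] [IsDomain O]
    [CommRing B] [Algebra O B] (hB : IsAffineCurve O B) {ρ : GaAction O B} (hρ : ρ.IsFree) {a : B}
    (ha : ρ.IsInvariant a) : ∃ v u : O, v ≠ 0 ∧ v • a = algebraMap O B u := by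
  have := hB.isDomain
  have := hB.faithfullyFlat
  have := hB.finiteType
  let k₀ := (⊥ : Ideal O).ResidueField
  have hk₀ : Algebra.IsAlgebraic O k₀ := Algebra.IsAlgebraic.trans O (O ⧸ (⊥ : Ideal O)) k₀
  have hinj : Function.Injective (algebraMap O k₀) := by
    rw [injective_iff_map_eq_zero]
    intro x hx
    rwa [Ideal.algebraMap_residueField_eq_zero, Ideal.mem_bot] at hx
  have h1 : IsAlgebraic k₀ ((1 : k₀) ⊗ₜ[O] a) :=
    GaAction.isAlgebraic_of_isInvariant (hB.relativeDimension ⊥).le (ρ.baseChange k₀)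
      (hρ.baseChange k₀) (GaAction.IsInvariant.baseChange k₀ (by rw [ha, map_C]; rfl))
  have h2 : IsAlgebraic O ((1 : k₀) ⊗ₜ[O] a) := h1.restrictScalars O
  have h3 : IsAlgebraic O a := (isAlgebraic_algHom_iff
    (Algebra.TensorProduct.includeRight : B →ₐ[O] k₀ ⊗[O] B)
    (Algebra.TensorProduct.includeRight_injective hinj)).1 h2
  obtain ⟨u, v, hv, h⟩ := hB.algebraicallyClosed (algebraMap B (FractionRing B) a) h3.algebraMap
  refine ⟨v, u, hv, IsFractionRing.injective B (FractionRing B) ?_⟩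
  rw [Algebra.smul_def, map_mul, ← IsScalarTower.algebraMap_apply,
    ← IsScalarTower.algebraMap_apply, h]

end Fibres

/-- A polynomial translation `l` divisible by `t` is `t ^ n * l'` with `l'` nonconstant in the
special fibre. -/
theorem exists_eq_C_pow_mul {O k : Type*} [CommRing O] [IsDomain O] [IsDiscreteValuationRing O]
    [Field k] [Algebra O k] {t : O} (ht : Irreducible t)
    (htk : ∀ r, algebraMap O k r = 0 ↔ t ∣ r) {l : O[X]} (hl : l ≠ 0) (hl0 : l.coeff 0 = 0)
    (htl : C t ∣ l) : ∃ (n : ℕ) (l' : O[X]), 1 ≤ n ∧ l = C t ^ n * l' ∧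
      (l'.map (algebraMap O k)).natDegree ≠ 0 := by
  have hp : Prime (C t : O[X]) := prime_C_iff.2 ht.prime
  obtain ⟨l', hl', hndvd⟩ :=
    (FiniteMultiplicity.of_not_isUnit hp.not_isUnit hl).exists_eq_pow_mul_and_not_dvd
  refine ⟨_, l', ?_, hl', fun h ↦ hndvd (C_dvd_iff_dvd_coeff _ _ |>.2 fun i ↦ (htk _).1 ?_)⟩
  · by_contra! h
    rw [Nat.lt_one_iff.1 h, pow_zero, one_mul] at hl'
    exact hndvd (hl' ▸ htl)
  · rw [← coeff_map]
    rcases i.eq_zero_or_pos with rfl | hi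
    · rw [hl', ← C_pow, coeff_C_mul] at hl0
      rw [coeff_map, (mul_eq_zero.1 hl0).resolve_left (pow_ne_zero _ ht.ne_zero), map_zero]
    · exact coeff_eq_zero_of_natDegree_lt (h ▸ hi)

/-- An additive coordinate is transcendental: apply the action to a relation and compare degrees. -/
theorem GaAction.IsSlice.eq_zero_of_aeval_eq_zero {O B : Type*} [CommRing O] [CommRing B]
    [IsDomain B] [Algebra O B] [FaithfulSMul O B] {ρ : GaAction O B} {b : B} {l : O[X]}
    (h : ρ.IsSlice b l) {q : O[X]} (hq : aeval b q = 0) : q = 0 := by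
  have hinj := FaithfulSMul.algebraMap_injective O B
  have h1 : (q.map (algebraMap O B)).comp (ρ.exp b) = 0 := by
    rw [comp, eval₂_map, ← map_zero ρ.exp, ← hq, ← aeval_algHom_apply, aeval_def]
    congr 1
  have h2 : (ρ.exp b).natDegree ≠ 0 := by
    rw [h.exp_eq, natDegree_C_add, natDegree_map_eq_of_injective hinj]
    exact h.natDegree_ne_zero
  rcases comp_eq_zero_iff.1 h1 with h3 | ⟨-, h3⟩
  · exact (Polynomial.map_eq_zero_iff hinj).1 h3
  · exact absurd (h3 ▸ natDegree_C _) h2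

theorem theorem1p1 {O : Type*} [CommRing O] [IsDomain O] [IsDiscreteValuationRing O]
    [PerfectField (IsLocalRing.ResidueField O)]
    (t : O) (ht : Irreducible t)
    {K : Type*} [Field K] [Algebra O K] [IsFractionRing O K]
    (p : ℕ) [ExpChar K p]
    {B : Type*} [CommRing B] [Algebra O B] (hB : IsAffineCurve O B)
    -- the special fibre is reduced
    (hred : IsReduced (B ⧸ Ideal.span {algebraMap O B t}))
    -- there is a free action of the additive group
    (hfree : ∃ ρ : GaAction O B, ρ.IsFree) :
    ∃ (n : ℕ) (f : Fin n → MvPolynomial (Fin n) O)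
      (e : B ≃ₐ[O] (MvPolynomial (Fin (n + 1)) O ⧸ presentationIdeal t f)),
      1 ≤ n ∧
      -- the `i`-th polynomial involves only the first `i` variables
      (∀ i : Fin n, f i ∈ MvPolynomial.supported O {j : Fin n | j ≤ i}) ∧
      -- (i)
      ringKrullDim (MvPolynomial (Fin n) O ⧸ centerIdeal t f n) = 0 ∧
      (centerIdeal t f n).IsRadical ∧
      (∀ i : Fin n, IsUnit (Ideal.Quotient.mk (centerIdeal t f ((i : ℕ) + 1))
        (MvPolynomial.pderiv i (f i)))) ∧
      -- (ii); the sequence `α` is determined by the two recursion equations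
      ∃ α : Fin (n + 1) → Polynomial K,
        α 0 = Polynomial.X ∧
        (∀ i : Fin n, α i.succ = Polynomial.C (algebraMap O K t)⁻¹ *
          MvPolynomial.aeval (fun j : Fin n => α j.castSucc) (f i)) ∧
        ∃ θ : (MvPolynomial (Fin (n + 1)) O ⧸ presentationIdeal t f) ≃ₐ[O]
            Algebra.adjoin O (Set.range α),
          (∀ i, (θ (Ideal.Quotient.mk _ (MvPolynomial.X i)) : Polynomial K) = α i) ∧
          ∃ Φ : GaAction O B ≃ {σ : GaAction K (Polynomial K) //
              σ.IsAdditive p ∧ σ.Stabilizes (Algebra.adjoin O (Set.range α))},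
            ∀ (ρ : GaAction O B) (i : ℕ) (b : B),
              ((θ (e (ρ.δ i b)) : Algebra.adjoin O (Set.range α)) : Polynomial K) =
                (Φ ρ).1.δ i (θ (e b) : Polynomial K) := by
  obtain ⟨ρ, hρ⟩ := hfree
  have := hB.isDomain
  have := hB.faithfullyFlat
  have := hB.finiteType
  -- the special fibre
  let m := IsLocalRing.maximalIdeal O
  let k := m.ResidueField
  let A := m.Fiber B
  let π : B →ₐ[O] A := Algebra.TensorProduct.includeRight
  have : PerfectField k := PerfectField.of_ringEquiv (K := IsLocalRing.ResidueField O)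
    (RingEquiv.ofBijective _ m.bijective_algebraMap_quotient_residueField)
  have hk : Function.Surjective (algebraMap O k) := Ideal.algebraMap_residueField_surjective m
  have hker : RingHom.ker (algebraMap O k) = Ideal.span {t} := by
    rw [← ht.maximalIdeal_eq]
    ext r
    exact Ideal.algebraMap_residueField_eq_zero
  have htk : ∀ r, algebraMap O k r = 0 ↔ t ∣ r := fun r ↦ by
    rw [← RingHom.mem_ker, hker, Ideal.mem_span_singleton]
  have htA : algebraMap O A t = 0 := by
    rw [IsScalarTower.algebraMap_apply O k A, (htk t).2 dvd_rfl, map_zero]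
  have hdim := hB.relativeDimension m
  have : Nontrivial A := by
    by_contra h
    rw [not_nontrivial_iff_subsingleton] at h
    rw [ringKrullDim_eq_bot_of_subsingleton] at hdim
    exact absurd hdim (by decide)
  have : IsReduced A := isReduced_tensorProduct hk hker
  have hπ : ∀ x, π x = 0 → ∃ c, x = t • c := by
    intro x hx
    have h := mem_map_ker_of_one_tmul_eq_zero hk hx
    rw [hker, Ideal.map_span, Set.image_singleton, Ideal.mem_span_singleton] at h
    obtain ⟨c, rfl⟩ := h
    exact ⟨c, (Algebra.smul_def _ _).symm⟩
  have halg : ∀ x, (ρ.exp x).map (π : B →+* A) = C (π x) → IsAlgebraic k (π x) := fun x hx ↦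
    GaAction.isAlgebraic_of_isInvariant hdim.le (ρ.baseChange k) (hρ.baseChange k)
      (GaAction.IsInvariant.baseChange k hx)
  -- the slice, rescaled so that its translation is divisible by `t`
  have : ExpChar O p :=
    (RingHom.expChar_iff (algebraMap O K) (IsFractionRing.injective O K) p).2 ‹_›
  have : ExpChar B p := expChar_of_injective_ringHom (FaithfulSMul.algebraMap_injective O B) p
  obtain ⟨b₀, l₀, hb₀⟩ := ρ.exists_isSlice p (fun a ↦ hB.exists_smul_eq_algebraMap hρ)
    hρ.exists_not_isInvariant
  have hslice := hb₀.smul ht.ne_zero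
  obtain ⟨n, l, hn, hl, hldeg⟩ := exists_eq_C_pow_mul (k := k) ht htk hslice.ne_zero
    hslice.coeff_zero (dvd_mul_right _ _)
  have hexp : ρ.exp (t • b₀) = C (t • b₀) + t ^ n • l.map (algebraMap O B) := by
    rw [hslice.exp_eq, hl, ← C_pow, Polynomial.map_mul, map_C, ← smul_eq_C_mul, algebraMap_smul]
  have htr : ∀ q : O[X], aeval (t • b₀) q = 0 → q = 0 := fun q ↦ hslice.eq_zero_of_aeval_eq_zero
  obtain ⟨f, b, hb, hT, htrans⟩ :=
    exists_isDilatationTower k ht.ne_zero hk htk hπ halg hexp n le_rfl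
  rw [← hb] at htr
  have hgen := hslice.exists_smul_eq_aeval
  rw [← hb] at hgen
  have hmem : ∀ g ∈ supported O (Set.Iic n), π (MvPolynomial.aeval b g) = 0 →
      g ∈ towerIdeal t f n := fun g hg hg0 ↦
    hT.mem_towerIdeal_of_isTranslatedBy (k := k) ((htk t).2 dvd_rfl) hπ hldeg htrans hg hg0
  let f' : Fin n → MvPolynomial (Fin n) O := fun i ↦ killAbove n (f i)
  let ev : MvPolynomial (Fin (n + 1)) O →ₐ[O] B := MvPolynomial.aeval fun j ↦ b j
  have hsurj : Function.Surjective ev := hT.aeval_surjective ht htA hmem hgen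
  have hkerev : presentationIdeal t f' = RingHom.ker ev := by
    ext q
    exact hT.mem_presentationIdeal_iff ht.ne_zero hmem htr
  let e' : (MvPolynomial (Fin (n + 1)) O ⧸ presentationIdeal t f') ≃ₐ[O] B :=
    (Ideal.quotientEquivAlgOfEq O hkerev).trans (Ideal.quotientKerAlgEquivOfSurjective hsurj)
  have he' : ∀ q, e' (Ideal.Quotient.mk _ q) = ev q := fun q ↦ rfl
  obtain ⟨ι, hι, hιb⟩ := exists_algHom_polynomial (K := K) htr hgen
  let α : Fin (n + 1) → K[X] := fun j ↦ ι (b j)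
  have hrange : ι.range = Algebra.adjoin O (Set.range α) := by
    have h : ι.comp ev = MvPolynomial.aeval α := MvPolynomial.algHom_ext fun j ↦ by
      rw [AlgHom.comp_apply, MvPolynomial.aeval_X, MvPolynomial.aeval_X]
    rw [Algebra.adjoin_range_eq_range_aeval, ← h, AlgHom.range_comp,
      (AlgHom.range_eq_top ev).2 hsurj, Algebra.map_top]
  have hΦ := GaAction.exists_equiv_stabilizes p ι hι hιb hgen
  rw [hrange] at hΦ
  obtain ⟨Φ, hΦ⟩ := hΦ
  let θ : (MvPolynomial (Fin (n + 1)) O ⧸ presentationIdeal t f') ≃ₐ[O]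
      Algebra.adjoin O (Set.range α) :=
    (e'.trans (AlgEquiv.ofInjective ι hι)).trans (Subalgebra.equivOfEq _ _ hrange)
  have hθ : ∀ x, (θ x : K[X]) = ι (e' x) := fun x ↦ rfl
  have htK : algebraMap O K t ≠ 0 := by
    rw [Ne, FaithfulSMul.algebraMap_eq_zero_iff]
    exact ht.ne_zero
  refine ⟨n, f', e'.symm, hn, fun i ↦ MvPolynomial.killAbove_mem_supported (hT.mem_supported i i.2),
    hT.ringKrullDim_quotient_centerIdeal hk htA fun j hj ↦
      halg _ ((htrans j hj.le).map_exp htA (by omega)),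
    hT.isRadical_centerIdeal htA, hT.isUnit_pderiv, α, hιb, fun i ↦ ?_, θ, fun i ↦ ?_, Φ,
    fun ρ i a ↦ ?_⟩
  · have h : MvPolynomial.aeval (fun j : Fin n ↦ α j.castSucc) (f' i) = t • α i.succ := by
      rw [← map_smul ι]
      change _ = ι (t • b (i + 1))
      rw [← hT.aeval_killAbove i.2, ← MvPolynomial.comp_aeval_apply]
      rfl
    rw [h, ← algebraMap_smul K t, smul_eq_C_mul, ← mul_assoc, ← C_mul, inv_mul_cancel₀ htK, C_1,
      one_mul]
  · rw [hθ, he']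
    exact congrArg ι (MvPolynomial.aeval_X _ i)
  · rw [hθ, hθ, AlgEquiv.apply_symm_apply, AlgEquiv.apply_symm_apply, hΦ]
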